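/- Let $F$ be a real closed field (for example $F=\mathbb R$), let $K=F[\sqrt{-1}]$, let $z\mapsto\bar z$ be the nontrivial $F$-automorphism of $K$, and let $U=\{z\in K^\times : z\bar z=1\}$. Algebras are not assumed associative, unital or finite-dimensional. The centroid $C(A)$ of an $F$-algebra $A$ is the algebra of all $F$-linear operators on $A$ that commute with all left and right multiplications; $A$ is central simple if $A^2\neq 0$, the only ideals of $A$ are $0$ and $A$, and $C(A)=F\,\mathrm{id}$. Let $G$ be an abelian group and let $B=\bigoplus_{g\in G}B_g$ be a $G$-graded $F$-algebra. For $g\in G$ put $C(B)_g=\{c\in C(B) : c(B_h)\subseteq B_{gh}\text{ for all }h\in G\}$. Assume that $B$ is graded-central-simple: $B^2\ne 0$, the only graded ideals of $B$ are $0$ and $B$, and $C(B)_e=F\,\mathrm{id}$. Let $H=\{g\in G : C(B)_g\neq 0\}$ be the support of $C(B)$. For a subgroup $H$ of $G$ with quotient map $\pi:G\to G/H$, a $G/H$-graded $F$-algebra $A$ and a character (group homomorphism) $\chi:G\to U$, let $L_\pi^\chi(A)$ be the $F$-algebra of fixed points of the map $a\otimes z\otimes g\mapsto a\otimes\bar z\chi(g)\otimes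 g$ on the subalgebra $\bigoplus_{g\in G}A_{\pi(g)}\otimes_F K\otimes_F g$ of $A\otimes_F K\otimes_F FG$, with its natural $G$-grading (in degree $g$: the fixed points in $A_{\pi(g)}\otimes_F K\otimes_F g$). Theorem. $H$ is a subgroup of $G$. With $\pi:G\to G/H$ the quotient map, there exist a character $\chi:G\to U$, a central simple $F$-algebra $A$ and a $G/H$-grading on $A$ such that $B\cong L_\pi^\chi(A)$ as $G$-graded algebras. Moreover, $\chi$ can be taken to be any character $G\to U$ such that $L_\pi^\chi(F)\cong C(B)$ as $G$-graded algebras, where $F$ has the trivial $G/H$-grading: for every such $\chi$ there exist a central simple $F$-algebra $A$ and a $G/H$-grading on $A$ such that $B\cong L_\pi^\chi(A)$ as $G$-graded algebras. -/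

import Mathlib

universe u

open scoped TensorProduct

namespace GradedLoop

/-! Algebras are not assumed associative or unital: an `F`-algebra is a type with
`[NonUnitalNonAssocRing A] [Module F A] [IsScalarTower F A A] [SMulCommClass F A A]`,
i.e. a vector space with a bilinear multiplication. -/

section Gradings

variable (F : Type*) [Field F]

/-- A `G`-grading on the `F`-algebra `A`: a direct sum decomposition `A = ⨁ g, A_g` into subspaces
with `A_g A_h ⊆ A_{gh}`. -/
structure Grading (A : Type*) [NonUnitalNonAssocRing A] [Module F A] (G : Type*) [Group G] where
  comp : G → Submodule F A
  independent : iSupIndep comp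
  span : ⨆ g, comp g = ⊤
  mul_mem : ∀ {g h : G} {x y : A}, x ∈ comp g → y ∈ comp h → x * y ∈ comp (g * h)

/-- A subspace is a (two-sided) ideal. -/
def IsIdeal {A : Type*} [NonUnitalNonAssocRing A] [Module F A] (I : Submodule F A) : Prop :=
  ∀ a x : A, x ∈ I → a * x ∈ I ∧ x * a ∈ I

/-- `A² ≠ 0` and the only ideals of `A` are `0` and `A`. -/
def IsSimpleAlg (A : Type*) [NonUnitalNonAssocRing A] [Module F A] : Prop :=
  (∃ x y : A, x * y ≠ 0) ∧ ∀ I : Submodule F A, IsIdeal F I → I = ⊥ ∨ I = ⊤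

/-- `A² ≠ 0` and the only graded ideals of `A` (ideals `I` with `I = ⨁ g, I ∩ A_g`)
are `0` and `A`. -/
def IsGradedSimple {A : Type*} [NonUnitalNonAssocRing A] [Module F A] {G : Type*} [Group G]
    (Γ : Grading F A G) : Prop :=
  (∃ x y : A, x * y ≠ 0) ∧
    ∀ I : Submodule F A, IsIdeal F I → I = ⨆ g, I ⊓ Γ.comp g → I = ⊥ ∨ I = ⊤

/-- The centroid: the `F`-linear operators on `A` that commute with all left and right
multiplications. -/
def centroid (A : Type*) [NonUnitalNonAssocRing A] [Module F A]
    [IsScalarTower F A A] [SMulCommClass F A A] : Subalgebra F (Module.End F A) where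
  carrier := {c | ∀ x y : A, c (x * y) = x * c y ∧ c (x * y) = c x * y}
  mul_mem' {c d} hc hd x y := by
    refine ⟨?_, ?_⟩
    · rw [Module.End.mul_apply, (hd x y).1, (hc _ _).1, Module.End.mul_apply]
    · rw [Module.End.mul_apply, (hd x y).2, (hc _ _).2, Module.End.mul_apply]
  add_mem' {c d} hc hd x y := by
    refine ⟨?_, ?_⟩
    · rw [LinearMap.add_apply, (hc x y).1, (hd x y).1, LinearMap.add_apply, mul_add]
    · rw [LinearMap.add_apply, (hc x y).2, (hd x y).2, LinearMap.add_apply, add_mul]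
  algebraMap_mem' r x y := by
    simp [Module.algebraMap_end_apply, mul_smul_comm, smul_mul_assoc]

/-- The centroid consists of the scalar operators. -/
def IsCentralAlg (A : Type*) [NonUnitalNonAssocRing A] [Module F A]
    [IsScalarTower F A A] [SMulCommClass F A A] : Prop :=
  ∀ c ∈ centroid F A, ∃ r : F, ∀ x : A, c x = r • x

/-- The degree-preserving elements of the centroid are the scalar operators. -/
def IsGradedCentral {A : Type*} [NonUnitalNonAssocRing A] [Module F A]
    [IsScalarTower F A A] [SMulCommClass F A A] {G : Type*} [Group G]
    (Γ : Grading F A G) : Prop :=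
  ∀ c ∈ centroid F A, (∀ h, ∀ x ∈ Γ.comp h, c x ∈ Γ.comp h) → ∃ r : F, ∀ x : A, c x = r • x

/-- `C(A)_g`: the elements `c` of the centroid with `c(A_h) ⊆ A_{gh}` for all `h`. -/
def centroidComp {A : Type*} [NonUnitalNonAssocRing A] [Module F A]
    [IsScalarTower F A A] [SMulCommClass F A A] {G : Type*} [Group G]
    (Γ : Grading F A G) (g : G) : Submodule F (centroid F A) where
  carrier := {c | ∀ h, ∀ x ∈ Γ.comp h, (c : Module.End F A) x ∈ Γ.comp (g * h)}
  add_mem' hc hd h x hx := (Γ.comp (g * h)).add_mem (hc h x hx) (hd h x hx)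
  zero_mem' h _ _ := (Γ.comp (g * h)).zero_mem
  smul_mem' r _ hc h x hx := (Γ.comp (g * h)).smul_mem r (hc h x hx)

/-- The support of the centroid. -/
def centroidSupport {A : Type*} [NonUnitalNonAssocRing A] [Module F A]
    [IsScalarTower F A A] [SMulCommClass F A A] {G : Type*} [Group G]
    (Γ : Grading F A G) : Set G :=
  {g | centroidComp F Γ g ≠ ⊥}

/-- `A` and `B`, with the families `𝒜` and `ℬ` of homogeneous components, are isomorphic as
graded `F`-algebras: there is a bijective linear multiplicative map that, together with its
inverse, preserves degrees. -/
def GradedIso {A B : Type*} [NonUnitalNonAssocSemiring A] [Module F A]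
    [NonUnitalNonAssocSemiring B] [Module F B] {G : Type*}
    (𝒜 : G → Submodule F A) (ℬ : G → Submodule F B) : Prop :=
  ∃ e : A ≃ₗ[F] B, (∀ x y : A, e (x * y) = e x * e y) ∧ ∀ (g : G) (x : A), x ∈ 𝒜 g ↔ e x ∈ ℬ g

open scoped Classical in
/-- The ground field with the trivial grading (everything in degree `1`). -/
noncomputable def trivialGrading (Q : Type*) [Group Q] : Grading F F Q where
  comp q := if q = 1 then ⊤ else ⊥
  independent := by
    intro q
    by_cases hq : q = 1
    · have : (⨆ j, ⨆ (_ : j ≠ q), (if j = 1 then (⊤ : Submodule F F) else ⊥)) = ⊥ := by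
        refine iSup₂_eq_bot.2 fun j hj => ?_
        rw [if_neg (fun h => hj (h.trans hq.symm))]
      rw [this]
      exact disjoint_bot_right
    · simp only [if_neg hq]
      exact disjoint_bot_left
  span := by
    refine top_le_iff.1 ?_
    refine le_trans ?_ (le_iSup (fun q : Q => if q = 1 then (⊤ : Submodule F F) else ⊥) 1)
    rw [if_pos rfl]
  mul_mem := by
    intro g h x y hx hy
    by_cases hg : g = 1
    · by_cases hh : h = 1
      · rw [if_pos (by rw [hg, hh, mul_one])]
        trivial
      · rw [if_neg hh, Submodule.mem_bot] at hy
        rw [hy, mul_zero]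
        exact Submodule.zero_mem _
    · rw [if_neg hg, Submodule.mem_bot] at hx
      rw [hx, zero_mul]
      exact Submodule.zero_mem _

end Gradings

section Loop

/-! Here `K` plays the role of `ℂ = F[√-1]`, and `conj` is the nontrivial automorphism of
`K` over `F`. -/

variable {F : Type*} [Field F] {K : Type*} [Field K] [Algebra F K] (conj : K ≃ₐ[F] K)

/-- The unit circle `U = {z | z * conj z = 1}` in `Kˣ`. -/
def unitCircle : Subgroup Kˣ where
  carrier := {z | (z : K) * conj (z : K) = 1}
  one_mem' := by simp
  mul_mem' {z w} hz hw := by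
    have hz' : (z : K) * conj (z : K) = 1 := hz
    have hw' : (w : K) * conj (w : K) = 1 := hw
    change ((z * w : Kˣ) : K) * conj ((z * w : Kˣ) : K) = 1
    rw [Units.val_mul, map_mul, mul_mul_mul_comm, hz', hw', mul_one]
  inv_mem' {z} hz := by
    have hz' : (z : K) * conj (z : K) = 1 := hz
    change ((z⁻¹ : Kˣ) : K) * conj ((z⁻¹ : Kˣ) : K) = 1
    rw [Units.val_inv_eq_inv_val, map_inv₀, ← mul_inv, hz', inv_one]

variable {G : Type*} [CommGroup G]

/-- The semilinear action of `conj` on the group algebra `K G = K ⊗ F G` given by a character `χ`: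
it sends `z g` to `conj z * χ(g) g`. -/
noncomputable def twistGroupAlg (χ : G →* unitCircle conj) :
    MonoidAlgebra K G →ₐ[F] MonoidAlgebra K G :=
  MonoidAlgebra.liftNCAlgHom
    ((MonoidAlgebra.singleOneAlgHom (R := F) (A := K) (M := G)).comp conj.toAlgHom)
    { toFun := fun g => MonoidAlgebra.single g ((χ g : Kˣ) : K)
      map_one' := by simp [MonoidAlgebra.one_def]
      map_mul' := fun g h => by simp [MonoidAlgebra.single_mul_single] }
    (fun _ _ => Commute.all _ _)

theorem twistGroupAlg_single (χ : G →* unitCircle conj) (g : G) (z : K) :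
    twistGroupAlg conj χ (MonoidAlgebra.single g z) =
      MonoidAlgebra.single g (conj z * ((χ g : Kˣ) : K)) := by
  simp [twistGroupAlg, MonoidAlgebra.single_mul_single]

variable {A : Type*} [NonUnitalNonAssocRing A] [Module F A]

section

variable (K)

/-- For a subgroup `H` of `G`, the quotient map `π : G → G/H` and a `G/H`-grading on `A`, this is
the degree `g` component `A_{π(g)} ⊗ K ⊗ g` of the loop algebra `L_π(A ⊗ K)`, inside
`A ⊗ K ⊗ F G = A ⊗ K G`. -/
noncomputable def loopCompExt {H : Subgroup G} (Γ : Grading F A (G ⧸ H)) (g : G) :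
    Submodule F (A ⊗[F] MonoidAlgebra K G) :=
  Submodule.span F {x | ∃ a ∈ Γ.comp (QuotientGroup.mk' H g), ∃ z : K,
    x = a ⊗ₜ[F] MonoidAlgebra.single g z}

end

variable [IsScalarTower F A A] [SMulCommClass F A A]

theorem lTensor_twist_mul (χ : G →* unitCircle conj) (x y : A ⊗[F] MonoidAlgebra K G) :
    (twistGroupAlg conj χ).toLinearMap.lTensor A (x * y) =
      (twistGroupAlg conj χ).toLinearMap.lTensor A x *
        (twistGroupAlg conj χ).toLinearMap.lTensor A y := by
  induction x with
  | zero => simp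
  | add x₁ x₂ h₁ h₂ => rw [add_mul, map_add, h₁, h₂, map_add, add_mul]
  | tmul a u =>
    induction y with
    | zero => simp
    | add y₁ y₂ h₁ h₂ => rw [mul_add, map_add, h₁, h₂, map_add, mul_add]
    | tmul b v => simp [Algebra.TensorProduct.tmul_mul_tmul]

theorem loopCompExt_mul {H : Subgroup G} (Γ : Grading F A (G ⧸ H)) {g h : G}
    {x y : A ⊗[F] MonoidAlgebra K G} (hx : x ∈ loopCompExt K Γ g) (hy : y ∈ loopCompExt K Γ h) :
    x * y ∈ loopCompExt K Γ (g * h) := by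
  unfold loopCompExt at hx hy
  induction hx using Submodule.span_induction with
  | zero => rw [zero_mul]; exact Submodule.zero_mem _
  | add x₁ x₂ _ _ h₁ h₂ => rw [add_mul]; exact Submodule.add_mem _ h₁ h₂
  | smul r x _ h₁ => rw [smul_mul_assoc]; exact Submodule.smul_mem _ r h₁
  | mem x hx =>
    induction hy using Submodule.span_induction with
    | zero => rw [mul_zero]; exact Submodule.zero_mem _
    | add x₁ x₂ _ _ h₁ h₂ => rw [mul_add]; exact Submodule.add_mem _ h₁ h₂
    | smul r x _ h₁ => rw [mul_smul_comm]; exact Submodule.smul_mem _ r h₁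
    | mem y hy =>
      obtain ⟨a, ha, z, rfl⟩ := hx
      obtain ⟨b, hb, w, rfl⟩ := hy
      refine Submodule.subset_span ⟨a * b, ?_, z * w, ?_⟩
      · rw [map_mul]
        exact Γ.mul_mem ha hb
      · rw [Algebra.TensorProduct.tmul_mul_tmul, MonoidAlgebra.single_mul_single]

theorem iSup_loopCompExt_mul {H : Subgroup G} (Γ : Grading F A (G ⧸ H))
    {x y : A ⊗[F] MonoidAlgebra K G} (hx : x ∈ ⨆ g, loopCompExt K Γ g)
    (hy : y ∈ ⨆ g, loopCompExt K Γ g) : x * y ∈ ⨆ g, loopCompExt K Γ g := by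
  induction hx using Submodule.iSup_induction' with
  | zero => rw [zero_mul]; exact Submodule.zero_mem _
  | add x₁ x₂ _ _ h₁ h₂ => rw [add_mul]; exact Submodule.add_mem _ h₁ h₂
  | mem g x hx =>
    induction hy using Submodule.iSup_induction' with
    | zero => rw [mul_zero]; exact Submodule.zero_mem _
    | add x₁ x₂ _ _ h₁ h₂ => rw [mul_add]; exact Submodule.add_mem _ h₁ h₂
    | mem h y hy => exact Submodule.mem_iSup_of_mem (g * h) (loopCompExt_mul Γ hx hy)

/-- The loop algebra `L_π^χ(A)`: the fixed points in `L_π(A ⊗ K) = ⨁ g, A_{π(g)} ⊗ K ⊗ g` of the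
semilinear action `a ⊗ z ⊗ g ↦ a ⊗ conj z * χ(g) ⊗ g`. -/
noncomputable def loopAlg {H : Subgroup G} (Γ : Grading F A (G ⧸ H)) (χ : G →* unitCircle conj) :
    NonUnitalSubalgebra F (A ⊗[F] MonoidAlgebra K G) where
  carrier := {x | x ∈ ⨆ g, loopCompExt K Γ g ∧ (twistGroupAlg conj χ).toLinearMap.lTensor A x = x}
  zero_mem' := ⟨Submodule.zero_mem _, map_zero _⟩
  add_mem' {x y} hx hy := ⟨Submodule.add_mem _ hx.1 hy.1, by rw [map_add, hx.2, hy.2]⟩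
  smul_mem' r x hx := ⟨Submodule.smul_mem _ r hx.1, by rw [map_smul, hx.2]⟩
  mul_mem' {x y} hx hy :=
    ⟨iSup_loopCompExt_mul Γ hx.1 hy.1, by rw [lTensor_twist_mul, hx.2, hy.2]⟩

/-- The homogeneous component of degree `g` of `L_π^χ(A)`. -/
noncomputable def loopComp {H : Subgroup G} (Γ : Grading F A (G ⧸ H)) (χ : G →* unitCircle conj)
    (g : G) : Submodule F (loopAlg conj Γ χ) :=
  (loopCompExt K Γ g).comap (NonUnitalSubalgebra.toSubmodule (loopAlg conj Γ χ)).subtype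

end Loop

end GradedLoop

/-! Since `B` is graded-simple, nonzero homogeneous elements of its centroid are invertible and
commute. Since `B` is also graded-central, the homogeneous units `homogeneousUnits Γ` form an
abelian extension of `H` by `Fˣ`. The field `K` is algebraically closed, so `Kˣ` is divisible and
the inclusion of `Fˣ` extends to a character `ρ` of this group. The quotient `ρ / conj ρ` takes
values in `U` and is trivial on `Fˣ`, so it descends to `H`. It then extends to `χ` on `G`, because
`U` is divisible as well. Degree and `ρ` together identify the homogeneous units of the centroid
with those of `L_π^χ(F)`. Such an identification (`CentroidSection`) is all that the rest of the
proof uses about `χ`, and any graded isomorphism `L_π^χ(F) ≅ C(B)` supplies one; this covers both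
existence claims.

Given `χ`, Hilbert 90 yields `w g ∈ Kˣ` with `w g / conj (w g) = χ(g)⁻¹`. The coboundary `w g * w h
/ w (g * h)` is fixed by `conj`, hence is a symmetric 2-cocycle with values in `F`. The algebra `A`
is the sum of one component of `B` per coset of `H`: multiply in `B`, rescale by the cocycle, and
return to the chosen component by a unit of the centroid. The resulting map `p : B → A`
(`TwistedCover`) is multiplicative up to the cocycle, and `x ↦ p x ⊗ (w g)⁻¹ g` for `x ∈ B_g` is the
isomorphism onto the loop algebra (`TwistedCover.gradedIso`).

Graded simplicity and graded centrality pass from `B` to `A`. A homogeneous element of `C(A)` lifts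
to one of `C(B)`, so it vanishes unless its degree is trivial in `G/H`. A minimal-support argument
(`IsGradedSimple.isSimpleAlg`) and the homogeneous components of centroid elements
(`IsGradedCentral.isCentralAlg`) then show that `A` is simple and central. -/

namespace GradedLoop

/-! ### Algebraic closedness of `F(√-1)` for real closed `F`. -/

section RealClosed

open Polynomial

variable {F : Type*} [Field F]

theorem eq_zero_of_sq_add_sq_add_sq [IsSemireal F] {a b c : F}
    (h : a * a + b * b + c * c = 0) : c = 0 := by
  by_contra hc
  refine IsSemireal.one_add_ne_zero (R := F) (s := a / c * (a / c) + (b / c * (b / c) + 0))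
    (.sq_add _ (.sq_add _ .zero)) ?_
  field_simp
  linear_combination h

theorem finrank_eq_one_of_odd [IsRealClosed F] (M : Type*) [Field M] [Algebra F M]
    [FiniteDimensional F M] (h : Odd (Module.finrank F M)) : Module.finrank F M = 1 := by
  obtain ⟨α, hα⟩ := Field.exists_primitive_element F M
  have hint : IsIntegral F α := Algebra.IsIntegral.isIntegral α
  have hdeg : (minpoly F α).natDegree = Module.finrank F M :=
    (Field.primitive_element_iff_minpoly_natDegree_eq F α).1 hα
  obtain ⟨x, hx⟩ := IsRealClosed.exists_isRoot_of_odd_natDegree (hdeg ▸ h)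
  rw [← hdeg]
  exact natDegree_eq_of_degree_eq_some
    (degree_eq_one_of_irreducible_of_root (minpoly.irreducible hint) hx)

variable {K : Type*} [Field K] [Algebra F K] {i : K}

theorem exists_eq_add_mul (hi : i * i = -1) (hK : Algebra.adjoin F {i} = ⊤) (z : K) :
    ∃ a b : F, z = algebraMap F K a + algebraMap F K b * i := by
  have hz : z ∈ Algebra.adjoin F {i} := hK ▸ Algebra.mem_top
  induction hz using Algebra.adjoin_induction with
  | mem x hx => exact ⟨0, 1, by simp [Set.mem_singleton_iff.1 hx]⟩
  | algebraMap r => exact ⟨r, 0, by simp⟩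
  | add x y _ _ hx hy =>
    obtain ⟨a, b, rfl⟩ := hx
    obtain ⟨c, d, rfl⟩ := hy
    exact ⟨a + c, b + d, by simp only [map_add]; ring⟩
  | mul x y _ _ hx hy =>
    obtain ⟨a, b, rfl⟩ := hx
    obtain ⟨c, d, rfl⟩ := hy
    refine ⟨a * c - b * d, a * d + b * c, ?_⟩
    simp only [map_add, map_sub, map_mul]
    linear_combination algebraMap F K b * algebraMap F K d * hi

/-- The half-angle formula: `a + b i = (s + (b / 2s) i)²` whenever `s² = (a + e) / 2` and `e² = a² +
b²`. -/
theorem isSquare_of_adjoin_sqrt_neg_one [IsRealClosed F] (hi : i * i = -1)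
    (hK : Algebra.adjoin F {i} = ⊤) (z : K) : IsSquare z := by
  obtain ⟨a, b, rfl⟩ := exists_eq_add_mul hi hK z
  have base : ∀ x : F, IsSquare (algebraMap F K x) := fun x => by
    rcases IsRealClosed.isSquare_or_isSquare_neg x with ⟨y, hy⟩ | ⟨y, hy⟩
    · exact ⟨algebraMap F K y, by rw [hy, map_mul]⟩
    · refine ⟨algebraMap F K y * i, ?_⟩
      have := congrArg (algebraMap F K) hy
      rw [map_neg, map_mul] at this
      linear_combination -this - algebraMap F K y * algebraMap F K y * hi
  by_cases hb : b = 0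
  · simpa [hb] using base a
  obtain ⟨d, hd⟩ : ∃ d, a * a + b * b = d * d := by
    rcases IsRealClosed.isSquare_or_isSquare_neg (a * a + b * b) with ⟨d, hd⟩ | ⟨d, hd⟩
    · exact ⟨d, hd⟩
    · refine absurd (eq_zero_of_sq_add_sq_add_sq (a := a) (b := d) (c := b) ?_) hb
      linear_combination -hd
  have key : ∀ e : F, a * a + b * b = e * e → IsSquare ((a + e) / 2) →
      IsSquare (algebraMap F K a + algebraMap F K b * i) := by
    rintro e he ⟨s, hs⟩
    have hs0 : s ≠ 0 := by
      rintro rfl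
      have h2 : a = -e := by linear_combination 2 * hs
      exact hb (mul_self_eq_zero.1 (by linear_combination he - (a - e) * h2))
    refine ⟨algebraMap F K s + algebraMap F K (b / (2 * s)) * i, ?_⟩
    have h1 : a = s * s - b / (2 * s) * (b / (2 * s)) := by
      field_simp
      have h3 : a + e = 2 * s ^ 2 := by linear_combination 2 * hs
      linear_combination (2 * s ^ 2 - a + e) * h3 + he
    have h2 : b = 2 * (s * (b / (2 * s))) := by field_simp
    have h1' := congrArg (algebraMap F K) h1
    have h2' := congrArg (algebraMap F K) h2
    simp only [map_sub, map_mul, map_ofNat] at h1' h2'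
    linear_combination h1' + i * h2' -
      algebraMap F K (b / (2 * s)) * algebraMap F K (b / (2 * s)) * hi
  -- The numbers `(a + d) / 2` and `(a - d) / 2` have product `-b² / 4`. If the negatives of both
  -- are squares `s²` and `t²`, then `(2st)² + b² = 0`, which forces `b = 0`.
  rcases IsRealClosed.isSquare_or_isSquare_neg ((a + d) / 2) with h | ⟨s, hs⟩
  · exact key d hd h
  rcases IsRealClosed.isSquare_or_isSquare_neg ((a + -d) / 2) with h | ⟨t, ht⟩
  · exact key (-d) (by rw [hd]; ring) h
  refine absurd (eq_zero_of_sq_add_sq_add_sq (a := 2 * (s * t)) (b := 0) (c := b) ?_) hb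
  linear_combination hd - 4 * t * t * hs + 2 * (a + d) * ht

theorem finrank_ne_two (h2 : (2 : K) ≠ 0) (hsq : ∀ z : K, IsSquare z) (M : Type*) [Field M]
    [Algebra K M] : Module.finrank K M ≠ 2 := by
  intro hM
  have : FiniteDimensional K M := Module.finite_of_finrank_pos (by omega)
  have hlt : ∀ y : M, ∃ x : K, algebraMap K M x = y := fun y => by
    have hint : IsIntegral K y := Algebra.IsIntegral.isIntegral y
    by_contra hy
    have hdvd : (minpoly K y).natDegree ∣ 2 := hM ▸ minpoly.degree_dvd hint
    have hne1 : (minpoly K y).natDegree ≠ 1 := fun h1 =>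
      hy (minpoly.natDegree_eq_one_iff.1 h1)
    have hdeg : (minpoly K y).natDegree = 2 :=
      ((Nat.dvd_prime Nat.prime_two).1 hdvd).resolve_left hne1
    have hmon := minpoly.monic hint
    obtain ⟨s, hs⟩ := hsq ((minpoly K y).coeff 1 * (minpoly K y).coeff 1 -
      4 * (minpoly K y).coeff 0)
    have hlead : (minpoly K y).coeff 2 = 1 := by rw [← hdeg]; exact hmon
    have hroot : (minpoly K y).IsRoot ((-(minpoly K y).coeff 1 + s) / 2) := by
      rw [IsRoot.def, eval_eq_sum_range, hdeg]
      simp only [Finset.sum_range_succ, Finset.sum_range_zero, hlead]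
      field_simp
      linear_combination -hs
    have := natDegree_eq_of_degree_eq_some
      (degree_eq_one_of_irreducible_of_root (minpoly.irreducible hint) hroot)
    exact hne1 this
  have : Module.finrank K M = 1 := by
    have hb : (⊥ : Subalgebra K M) = ⊤ := by
      rw [eq_top_iff]
      intro y _
      exact Algebra.mem_bot.2 (hlt y)
    rw [← Subalgebra.bot_eq_top_iff_finrank_eq_one]
    exact hb
  omega

/-- Artin's argument. The fixed field of a Sylow 2-subgroup has odd degree over `F`, so it is `F`
and `[N : F]` is a power of 2. If `[N : K] = 2 ^ (m + 1)`, a subgroup of order `2 ^ m` in `Gal(N/K)`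
would fix a quadratic extension of `K`, but every element of `K` is a square. -/
theorem finrank_eq_one_of_isGalois [IsRealClosed F] (hi : i * i = -1)
    (hK : Algebra.adjoin F {i} = ⊤) (N : Type*) [Field N] [Algebra F N] [Algebra K N]
    [IsScalarTower F K N] [FiniteDimensional F N] [IsGalois F N] : Module.finrank K N = 1 := by
  have : Fact (Nat.Prime 2) := ⟨Nat.prime_two⟩
  have : IsGalois K N := IsGalois.tower_top_of_isGalois F K N
  have : FiniteDimensional K N := FiniteDimensional.right F K N
  have : FiniteDimensional F K := FiniteDimensional.left F K N
  have h2 : (2 : K) ≠ 0 := by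
    have := (algebraMap F K).injective.ne (two_ne_zero (α := F))
    rwa [map_ofNat, map_zero] at this
  have hpow : ∃ n, Module.finrank F N = 2 ^ n := by
    let P : Sylow 2 Gal(N/F) := default
    have hindex : ¬ 2 ∣ (P : Subgroup Gal(N/F)).index := P.not_dvd_index
    have hcard : Nat.card (P : Subgroup Gal(N/F)) * (P : Subgroup Gal(N/F)).index =
        Module.finrank F N := by
      rw [Subgroup.card_mul_index, IsGalois.card_aut_eq_finrank]
    have hfix := IntermediateField.finrank_fixedField_eq_card (P : Subgroup Gal(N/F))
    have htower := Module.finrank_mul_finrank F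
      (IntermediateField.fixedField (P : Subgroup Gal(N/F))) N
    have hpos : 0 < Nat.card (P : Subgroup Gal(N/F)) := Nat.card_pos
    have hidx : Module.finrank F (IntermediateField.fixedField (P : Subgroup Gal(N/F))) =
        (P : Subgroup Gal(N/F)).index := by
      rw [hfix, ← hcard, mul_comm] at htower
      exact Nat.eq_of_mul_eq_mul_left hpos htower
    have hone := finrank_eq_one_of_odd
      (IntermediateField.fixedField (P : Subgroup Gal(N/F)))
      (by rw [hidx]; exact Nat.not_even_iff_odd.1 fun h => hindex h.two_dvd)
    obtain ⟨n, hn⟩ := P.isPGroup'.exists_card_eq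
    refine ⟨n, ?_⟩
    rw [← hcard, ← hidx, hone, mul_one, hn]
  obtain ⟨n, hn⟩ := hpow
  have hdvd : Module.finrank K N ∣ 2 ^ n := by
    rw [← hn, ← Module.finrank_mul_finrank F K N]
    exact dvd_mul_left _ _
  obtain ⟨m, -, hm⟩ := (Nat.dvd_prime_pow Nat.prime_two).1 hdvd
  cases m with
  | zero => simpa using hm
  | succ m =>
    exfalso
    obtain ⟨Q, hQ⟩ := Sylow.exists_subgroup_card_pow_prime (G := Gal(N/K)) 2 (n := m) (by
      rw [IsGalois.card_aut_eq_finrank, hm]; exact pow_dvd_pow _ (Nat.le_succ m))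
    have hfix := IntermediateField.finrank_fixedField_eq_card Q
    have htower := Module.finrank_mul_finrank K (IntermediateField.fixedField Q) N
    rw [hfix, hm, hQ, pow_succ, mul_comm] at htower
    exact finrank_ne_two h2 (isSquare_of_adjoin_sqrt_neg_one hi hK) _
      (Nat.eq_of_mul_eq_mul_left (pow_pos two_pos m) htower)

/-- The fundamental theorem of algebra over a real closed field. -/
theorem isAlgClosed_of_adjoin_sqrt_neg_one [IsRealClosed F] (hi : i * i = -1)
    (hK : Algebra.adjoin F {i} = ⊤) : IsAlgClosed K := by
  have hfin : FiniteDimensional F K := by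
    have hint : IsIntegral F i := ⟨X ^ 2 + 1, by monicity!, by simp [pow_two, hi]⟩
    have := hint.fg_adjoin_singleton
    rw [hK] at this
    exact ⟨this⟩
  refine IsAlgClosed.of_exists_root _ fun p hp hirr => ?_
  have : Fact (Irreducible p) := ⟨hirr⟩
  let E := AdjoinRoot p
  have : FiniteDimensional K E := (AdjoinRoot.powerBasis hirr.ne_zero).finite
  have : FiniteDimensional F E := FiniteDimensional.trans F K E
  let L := AlgebraicClosure E
  have : Algebra.IsAlgebraic F L := Algebra.IsAlgebraic.trans F E L
  have : IsAlgClosure F L := ⟨inferInstance, inferInstance⟩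
  have : Normal F L := IsAlgClosure.normal F L
  let N := IntermediateField.normalClosure F E L
  let : Algebra K N := ((algebraMap E N).comp (algebraMap K E)).toAlgebra
  have : IsScalarTower K E N := IsScalarTower.of_algebraMap_eq' rfl
  have : IsScalarTower F K N := IsScalarTower.of_algebraMap_eq' (by
    rw [IsScalarTower.algebraMap_eq F E N, IsScalarTower.algebraMap_eq F K E]; rfl)
  have : IsGalois F N := ⟨⟩
  have h1 := finrank_eq_one_of_isGalois hi hK N
  rw [← Module.finrank_mul_finrank K E N] at h1
  have h2 : Module.finrank K E = 1 := Nat.eq_one_of_mul_eq_one_right h1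
  rw [PowerBasis.finrank (AdjoinRoot.powerBasis hirr.ne_zero), AdjoinRoot.powerBasis_dim] at h2
  have h3 : p.degree = 1 := by
    rw [degree_eq_natDegree hirr.ne_zero, h2]; rfl
  exact exists_root_of_degree_eq_one h3

end RealClosed

/-! ### The unit circle: Hilbert 90 and divisibility. -/

section Conj

variable {F : Type*} [Field F] {K : Type*} [Field K] [Algebra F K] {i : K} {conj : K ≃ₐ[F] K}

theorem conj_conj (hi : i * i = -1) (hK : Algebra.adjoin F {i} = ⊤) (hconj : conj i = -i)
    (z : K) : conj (conj z) = z := by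
  obtain ⟨a, b, rfl⟩ := exists_eq_add_mul hi hK z
  simp [hconj]

theorem two_mul_i_ne_zero [CharZero F] (hi : i * i = -1) : 2 * i ≠ 0 := by
  have h2 : (2 : K) ≠ 0 := by
    have := (algebraMap F K).injective.ne (two_ne_zero (α := F))
    rwa [map_ofNat, map_zero] at this
  refine mul_ne_zero h2 ?_
  rintro rfl
  simp at hi

theorem exists_algebraMap_eq_of_conj_eq [CharZero F] (hi : i * i = -1)
    (hK : Algebra.adjoin F {i} = ⊤) (hconj : conj i = -i) {z : K} (hz : conj z = z) :
    ∃ r : F, algebraMap F K r = z := by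
  obtain ⟨a, b, rfl⟩ := exists_eq_add_mul hi hK z
  refine ⟨a, ?_⟩
  simp only [map_add, map_mul, AlgEquiv.commutes, hconj] at hz
  have : algebraMap F K b * (2 * i) = 0 := by linear_combination -hz
  rcases mul_eq_zero.1 this with h | h
  · rw [h]; ring
  · exact absurd h (two_mul_i_ne_zero (F := F) hi)

theorem unitCircle_conj (u : unitCircle conj) :
    conj ((u : Kˣ) : K) = (((u : Kˣ) : K))⁻¹ :=
  eq_inv_of_mul_eq_one_right u.2

/-- Hilbert 90 for `K/F`: `w = 1 + u` works unless it vanishes, and for `u = -1` the element `i`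
does. -/
theorem exists_unit_eq_conj_mul [CharZero F] (hi : i * i = -1) (hconj : conj i = -i)
    (u : unitCircle conj) : ∃ w : Kˣ, (w : K) = conj (w : K) * ((u : Kˣ) : K) := by
  have hu := unitCircle_conj u
  have hu0 : ((u : Kˣ) : K) ≠ 0 := (u : Kˣ).ne_zero
  by_cases h : (1 : K) + ((u : Kˣ) : K) = 0
  · have hi0 : i ≠ 0 := right_ne_zero_of_mul (two_mul_i_ne_zero (F := F) hi)
    refine ⟨Units.mk0 i hi0, ?_⟩
    rw [Units.val_mk0, hconj]
    linear_combination i * h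
  · refine ⟨Units.mk0 _ h, ?_⟩
    rw [Units.val_mk0, map_add, map_one, hu]
    field_simp
    ring

/-- Write `u = w / conj w` and take `v` with `v ^ n = w`; then `v / conj v` is an `n`-th root of `u`
on the circle. -/
theorem pow_surjective_unitCircle [IsRealClosed F] (hi : i * i = -1)
    (hK : Algebra.adjoin F {i} = ⊤) (hconj : conj i = -i) {n : ℕ} (hn : n ≠ 0) :
    Function.Surjective fun u : unitCircle conj => u ^ n := by
  intro u
  have := isAlgClosed_of_adjoin_sqrt_neg_one hi hK
  obtain ⟨w, hw⟩ := exists_unit_eq_conj_mul hi hconj u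
  obtain ⟨v, hv⟩ := IsAlgClosed.exists_pow_nat_eq (w : K) (Nat.pos_of_ne_zero hn)
  have hv0 : v ≠ 0 := by
    rintro rfl
    rw [zero_pow hn] at hv
    exact w.ne_zero hv.symm
  refine ⟨⟨Units.mk0 v hv0 / Units.mk0 (conj v) (by simpa using hv0), ?_⟩, ?_⟩
  · change ((_ : Kˣ) : K) * conj ((_ : Kˣ) : K) = 1
    rw [Units.val_div_eq_div_val, map_div₀, Units.val_mk0, Units.val_mk0, conj_conj hi hK hconj]
    have : conj v ≠ 0 := by simpa using hv0
    field_simp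
  · ext
    simp only [SubgroupClass.coe_pow, Units.val_pow_eq_pow_val, Units.val_div_eq_div_val,
      Units.val_mk0, div_pow]
    rw [← map_pow, hv, div_eq_iff (by simp), mul_comm]
    exact hw

end Conj

/-! ### Extension of characters with divisible values. -/

section Divisible

/-- A homomorphism into a divisible abelian group extends along an injective homomorphism. -/
theorem exists_extension_of_injective {X Y D : Type*} [CommGroup X] [CommGroup Y] [CommGroup D]
    (hD : ∀ n : ℕ, n ≠ 0 → Function.Surjective fun d : D => d ^ n)
    (f : X →* Y) (hf : Function.Injective f) (φ : X →* D) :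
    ∃ ψ : Y →* D, ∀ x, ψ (f x) = φ x := by
  let : DivisibleBy (Additive D) ℕ := divisibleByOfSMulRightSurj _ _
    fun {n} hn d => by
      obtain ⟨e, he⟩ := hD n hn d.toMul
      exact ⟨Additive.ofMul e, congrArg Additive.ofMul he⟩
  let : DivisibleBy (Additive D) ℤ := AddGroup.divisibleByIntOfDivisibleByNat _
  obtain ⟨h, hh⟩ := (Module.Baer.of_divisible (Additive D)).extension_property_addMonoidHom
    (MonoidHom.toAdditive f) hf (MonoidHom.toAdditive φ)
  exact ⟨AddMonoidHom.toMultiplicative h,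
    fun x => congrArg Additive.toMul (DFunLike.congr_fun hh (Additive.ofMul x))⟩

/-- A homomorphism into a divisible abelian group that is trivial on the kernel of `f` factors
through `f`. -/
theorem exists_extension_of_ker_le {X Y D : Type*} [CommGroup X] [CommGroup Y] [CommGroup D]
    (hD : ∀ n : ℕ, n ≠ 0 → Function.Surjective fun d : D => d ^ n)
    (f : X →* Y) (φ : X →* D) (hφ : f.ker ≤ φ.ker) :
    ∃ ψ : Y →* D, ∀ x, ψ (f x) = φ x := by
  obtain ⟨ψ, hψ⟩ := exists_extension_of_injective hD (QuotientGroup.kerLift f)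
    (QuotientGroup.kerLift_injective f) (QuotientGroup.lift f.ker φ fun x hx => hφ hx)
  exact ⟨ψ, fun x => hψ (QuotientGroup.mk x)⟩

end Divisible

/-! ### Homogeneous components and projections. -/

section GradingTools

open scoped DirectSum

variable {F : Type*} [Field F] {A : Type*} [NonUnitalNonAssocRing A] [Module F A]
  {G : Type*} [Group G] (Γ : Grading F A G) {M : Type*} [AddCommGroup M] [Module F M]

namespace Grading

@[elab_as_elim]
theorem induction {P : A → Prop} (x : A) (mem : ∀ g, ∀ y ∈ Γ.comp g, P y) (zero : P 0)
    (add : ∀ y z, P y → P z → P (y + z)) : P x := by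
  have hx : x ∈ ⨆ g, Γ.comp g := Γ.span ▸ Submodule.mem_top
  induction hx using Submodule.iSup_induction' with
  | zero => exact zero
  | add y z _ _ hy hz => exact add y z hy hz
  | mem g y hy => exact mem g y hy

theorem hom_ext {φ ψ : A →ₗ[F] M} (h : ∀ g, ∀ x ∈ Γ.comp g, φ x = ψ x) : φ = ψ := by
  ext x
  refine Γ.induction x h (by simp) fun y z hy hz => ?_
  rw [map_add, map_add, hy, hz]

open scoped Classical in
/-- The decomposition of an algebra as the direct sum of its homogeneous components. -/
noncomputable def decomp : A ≃ₗ[F] ⨁ g, Γ.comp g :=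
  (LinearEquiv.ofBijective (DirectSum.coeLinearMap Γ.comp)
    (DirectSum.isInternal_submodule_of_iSupIndep_of_iSup_eq_top Γ.independent Γ.span)).symm

open scoped Classical in
theorem decomp_of_mem {g : G} {x : A} (hx : x ∈ Γ.comp g) :
    Γ.decomp x = DirectSum.lof F G (fun g => Γ.comp g) g ⟨x, hx⟩ := by
  refine (LinearEquiv.symm_apply_eq _).2 ?_
  exact (DirectSum.coeLinearMap_lof Γ.comp g ⟨x, hx⟩).symm

open scoped Classical in
/-- The linear map with prescribed restrictions to the homogeneous components. -/
noncomputable def lift (φ : ∀ g, Γ.comp g →ₗ[F] M) : A →ₗ[F] M :=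
  (DirectSum.toModule F G M φ).comp Γ.decomp.toLinearMap

theorem lift_of_mem (φ : ∀ g, Γ.comp g →ₗ[F] M) {g : G} {x : A} (hx : x ∈ Γ.comp g) :
    Γ.lift φ x = φ g ⟨x, hx⟩ := by
  classical
  simp [lift, Γ.decomp_of_mem hx]

/-- The projection onto a homogeneous component. -/
noncomputable def proj (g : G) : A →ₗ[F] A :=
  (Γ.comp g).subtype.comp
    ((DirectSum.component F G (fun g => Γ.comp g) g).comp Γ.decomp.toLinearMap)

theorem proj_mem (g : G) (x : A) : Γ.proj g x ∈ Γ.comp g := Submodule.coe_mem _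

theorem proj_of_mem {g : G} {x : A} (hx : x ∈ Γ.comp g) : Γ.proj g x = x := by
  classical
  simp [proj, Γ.decomp_of_mem hx]

theorem proj_of_mem_of_ne {g k : G} {x : A} (hx : x ∈ Γ.comp g) (h : g ≠ k) :
    Γ.proj k x = 0 := by
  classical
  simp only [proj, LinearMap.comp_apply, LinearEquiv.coe_coe, Γ.decomp_of_mem hx]
  rw [DirectSum.component.of, dif_neg h, map_zero]

theorem eq_zero_of_proj {x : A} (h : ∀ g, Γ.proj g x = 0) : x = 0 := by
  rw [← Γ.decomp.map_eq_zero_iff]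
  refine DFinsupp.ext fun g => ?_
  exact Subtype.ext (h g)

theorem eq_of_proj {x y : A} (h : ∀ g, Γ.proj g x = Γ.proj g y) : x = y :=
  sub_eq_zero.1 (Γ.eq_zero_of_proj fun g => by rw [map_sub, h g, sub_self])

theorem mem_of_proj {g : G} {x : A} (h : ∀ k, k ≠ g → Γ.proj k x = 0) : x ∈ Γ.comp g := by
  have : x = Γ.proj g x := Γ.eq_of_proj fun k => by
    by_cases hk : k = g
    · subst hk
      rw [Γ.proj_of_mem (Γ.proj_mem k x)]
    · rw [h k hk, Γ.proj_of_mem_of_ne (Γ.proj_mem g x) (Ne.symm hk)]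
  rw [this]
  exact Γ.proj_mem g x

theorem finite_support (x : A) : {g | Γ.proj g x ≠ 0}.Finite := by
  refine Γ.induction x (fun g y hy => ?_) (by simp) fun y z hy hz => ?_
  · refine (Set.finite_singleton g).subset fun k hk => ?_
    by_contra h
    exact hk (Γ.proj_of_mem_of_ne hy (Ne.symm h))
  · refine (hy.union hz).subset fun k hk => ?_
    by_contra h
    simp only [Set.mem_union, Set.mem_ofPred_eq, not_or, not_not] at h
    exact hk (by rw [map_add, h.1, h.2, add_zero])

theorem exists_proj_ne_zero {x : A} (hx : x ≠ 0) : ∃ g, Γ.proj g x ≠ 0 := by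
  by_contra! h
  exact hx (Γ.eq_zero_of_proj h)

theorem proj_mul_of_mem_left {j : G} {y : A} (hy : y ∈ Γ.comp j) (k : G) (x : A) :
    Γ.proj (j * k) (y * x) = y * Γ.proj k x := by
  refine Γ.induction x (fun l z hz => ?_) (by simp) fun z w hz hw => ?_
  · by_cases h : l = k
    · subst h
      rw [Γ.proj_of_mem hz, Γ.proj_of_mem (Γ.mul_mem hy hz)]
    · rw [Γ.proj_of_mem_of_ne hz h, mul_zero,
        Γ.proj_of_mem_of_ne (Γ.mul_mem hy hz) fun h' => h (mul_left_cancel h')]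
  · rw [mul_add, map_add, map_add, hz, hw, mul_add]

theorem proj_mul_of_mem_right {j : G} {y : A} (hy : y ∈ Γ.comp j) (k : G) (x : A) :
    Γ.proj (k * j) (x * y) = Γ.proj k x * y := by
  refine Γ.induction x (fun l z hz => ?_) (by simp) fun z w hz hw => ?_
  · by_cases h : l = k
    · subst h
      rw [Γ.proj_of_mem hz, Γ.proj_of_mem (Γ.mul_mem hz hy)]
    · rw [Γ.proj_of_mem_of_ne hz h, zero_mul,
        Γ.proj_of_mem_of_ne (Γ.mul_mem hz hy) fun h' => h (mul_right_cancel h')]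
  · rw [add_mul, map_add, map_add, hz, hw, add_mul]

theorem exists_homogeneous_mul_ne_zero (h : ∃ x y : A, x * y ≠ 0) :
    ∃ g k, ∃ x ∈ Γ.comp g, ∃ y ∈ Γ.comp k, x * y ≠ 0 := by
  by_contra! h0
  obtain ⟨x, y, hxy⟩ := h
  refine hxy (Γ.induction x (fun g x hx => ?_) (by simp) fun a b ha hb => ?_)
  · refine Γ.induction y (fun k y hy => h0 g k x hx y hy) (by simp) fun a b ha hb => ?_
    rw [mul_add, ha, hb, add_zero]
  · rw [add_mul, ha, hb, add_zero]

variable [IsScalarTower F A A] [SMulCommClass F A A]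

theorem mem_centroid {c : Module.End F A}
    (h : ∀ j k, ∀ x ∈ Γ.comp j, ∀ y ∈ Γ.comp k, c (x * y) = x * c y ∧ c (x * y) = c x * y) :
    c ∈ centroid F A := by
  intro x y
  refine Γ.induction x (fun j x hx => ?_) (by simp) fun a b ha hb => ?_
  · refine Γ.induction y (fun k y hy => h j k x hx y hy) (by simp) fun a b ha hb => ?_
    constructor
    · rw [mul_add, map_add, map_add, ha.1, hb.1, mul_add]
    · rw [mul_add, map_add, ha.2, hb.2, mul_add]
  · constructor
    · rw [add_mul, map_add, ha.1, hb.1, add_mul]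
    · rw [add_mul, map_add, map_add, ha.2, hb.2, add_mul]

end Grading

end GradingTools

/-! ### Graded-simple algebras and their centroids. -/

section GradedSimple

variable {F : Type*} [Field F] {A : Type*} [NonUnitalNonAssocRing A] [Module F A]
  {G : Type*} [CommGroup G] {Γ : Grading F A G}

/-- A nonzero family of subspaces of the homogeneous components that is stable under
multiplication by homogeneous elements consists of the whole components. -/
theorem IsGradedSimple.eq_comp (hs : IsGradedSimple F Γ) {J : G → Submodule F A}
    (hle : ∀ k, J k ≤ Γ.comp k)
    (hmul : ∀ j k, ∀ y ∈ Γ.comp j, ∀ u ∈ J k, y * u ∈ J (j * k) ∧ u * y ∈ J (j * k))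
    (hne : ∃ k, ∃ u ∈ J k, u ≠ 0) (k : G) : J k = Γ.comp k := by
  have hideal : IsIdeal F (⨆ k, J k) := by
    intro a x hx
    induction hx using Submodule.iSup_induction' with
    | zero => simp
    | add x y _ _ hx hy =>
      rw [mul_add, add_mul]
      exact ⟨Submodule.add_mem _ hx.1 hy.1, Submodule.add_mem _ hx.2 hy.2⟩
    | mem k u hu =>
      refine Γ.induction a (fun j y hy => ?_) (by simp) fun y z hy hz => ?_
      · exact ⟨Submodule.mem_iSup_of_mem _ (hmul j k y hy u hu).1,
          Submodule.mem_iSup_of_mem _ (hmul j k y hy u hu).2⟩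
      · rw [mul_add, add_mul]
        exact ⟨Submodule.add_mem _ hy.1 hz.1, Submodule.add_mem _ hy.2 hz.2⟩
  have hgr : ⨆ k, J k = ⨆ k, (⨆ k, J k) ⊓ Γ.comp k :=
    le_antisymm (iSup_mono fun k => le_inf (le_iSup J k) (hle k)) (iSup_le fun k => inf_le_left)
  rcases hs.2 _ hideal hgr with h | h
  · obtain ⟨k, u, hu, hu0⟩ := hne
    have : u ∈ (⊥ : Submodule F A) := h ▸ Submodule.mem_iSup_of_mem k hu
    exact absurd ((Submodule.mem_bot F).1 this) hu0
  · refine le_antisymm (hle k) fun x hx => ?_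
    have hall : ∀ y ∈ ⨆ k, J k, Γ.proj k y ∈ J k := by
      intro y hy
      induction hy using Submodule.iSup_induction' with
      | zero => simp
      | add x y _ _ hx hy => rw [map_add]; exact Submodule.add_mem _ hx hy
      | mem j u hu =>
        by_cases hj : j = k
        · subst hj
          rwa [Γ.proj_of_mem (hle _ hu)]
        · rw [Γ.proj_of_mem_of_ne (hle _ hu) hj]
          exact Submodule.zero_mem _
    rw [← Γ.proj_of_mem hx]
    exact hall x (h ▸ Submodule.mem_top)

theorem proj_apply_of_degree {c : Module.End F A} {g : G}
    (hd : ∀ h, ∀ x ∈ Γ.comp h, c x ∈ Γ.comp (g * h)) (k : G) (x : A) :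
    Γ.proj (g * k) (c x) = c (Γ.proj k x) := by
  refine Γ.induction x (fun l z hz => ?_) (by simp) fun z w hz hw => ?_
  · by_cases h : l = k
    · subst h
      rw [Γ.proj_of_mem hz, Γ.proj_of_mem (hd _ _ hz)]
    · rw [Γ.proj_of_mem_of_ne hz h, map_zero,
        Γ.proj_of_mem_of_ne (hd _ _ hz) fun h' => h (mul_left_cancel h')]
  · simp only [map_add, hz, hw]

variable [IsScalarTower F A A] [SMulCommClass F A A]

/-- Nonzero homogeneous elements of the centroid of a graded-simple algebra are bijective. -/
theorem IsGradedSimple.bijective (hs : IsGradedSimple F Γ) {c : Module.End F A}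
    (hc : c ∈ centroid F A) {g : G} (hd : ∀ h, ∀ x ∈ Γ.comp h, c x ∈ Γ.comp (g * h))
    (hc0 : c ≠ 0) : Function.Bijective c := by
  obtain ⟨k, x, hx, hcx⟩ : ∃ k, ∃ x ∈ Γ.comp k, c x ≠ 0 := by
    by_contra! h
    exact hc0 (Γ.hom_ext h)
  constructor
  -- The homogeneous parts of the kernel are stable under multiplication; if one were nonzero they
  -- would fill `A`, against `c ≠ 0`.
  · have hker : ∀ k, ∀ x ∈ Γ.comp k, c x = 0 → x = 0 := by
      by_contra! h
      refine hcx ?_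
      have := hs.eq_comp (J := fun k => LinearMap.ker c ⊓ Γ.comp k) (fun k => inf_le_right)
        (fun j k y hy u hu => ?_) ?_ k
      · exact (this.symm ▸ hx : x ∈ LinearMap.ker c ⊓ Γ.comp k).1
      · have hu1 : c u = 0 := hu.1
        refine ⟨⟨?_, Γ.mul_mem hy hu.2⟩, ⟨?_, mul_comm j k ▸ Γ.mul_mem hu.2 hy⟩⟩
        · change c (y * u) = 0
          rw [(hc y u).1, hu1, mul_zero]
        · change c (u * y) = 0
          rw [(hc u y).2, hu1, zero_mul]
      · obtain ⟨k, x, hx, hx0, hne⟩ := h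
        exact ⟨k, x, ⟨hx0, hx⟩, hne⟩
    refine (injective_iff_map_eq_zero c).2 fun x hx => Γ.eq_zero_of_proj fun k => ?_
    refine hker k _ (Γ.proj_mem k x) ?_
    rw [← proj_apply_of_degree hd, hx, map_zero]
  · have := hs.eq_comp (J := fun k => (Γ.comp (g⁻¹ * k)).map c) (fun k => ?_) ?_ ?_
    · rw [← LinearMap.range_eq_top, eq_top_iff, ← Γ.span]
      refine iSup_le fun k => ?_
      rw [← this k]
      exact LinearMap.map_le_range
    · rintro _ ⟨x, hx, rfl⟩
      simpa using hd _ x hx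
    · rintro j k y hy _ ⟨x, hx, rfl⟩
      refine ⟨⟨y * x, ?_, (hc y x).1⟩, ⟨x * y, ?_, (hc x y).2⟩⟩
      · rw [mul_left_comm]
        exact Γ.mul_mem hy hx
      · rw [mul_left_comm, mul_comm]
        exact Γ.mul_mem hx hy
    · exact ⟨g * k, c x, ⟨x, by simpa using hx, rfl⟩, hcx⟩

/-- A graded-simple algebra whose centroid has no nonzero homogeneous elements of nontrivial
degree is simple. -/
theorem IsGradedSimple.isSimpleAlg (hs : IsGradedSimple F Γ)
    (hsupp : ∀ q : G, q ≠ 1 → ∀ c ∈ centroid F A,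
      (∀ h, ∀ x ∈ Γ.comp h, c x ∈ Γ.comp (q * h)) → c = 0) : IsSimpleAlg F A := by
  refine ⟨hs.1, fun I hI => or_iff_not_imp_left.2 fun hbot => ?_⟩
  -- an element of minimal support
  obtain ⟨a, ⟨haI, ha0⟩, hmin⟩ : ∃ a, (a ∈ I ∧ a ≠ 0) ∧ ∀ x, x ∈ I ∧ x ≠ 0 →
      {g | Γ.proj g a ≠ 0}.ncard ≤ {g | Γ.proj g x ≠ 0}.ncard := by
    obtain ⟨a, ha, h⟩ := (InvImage.wf (fun x : A => {g | Γ.proj g x ≠ 0}.ncard)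
      Nat.lt_wfRel.wf).has_min {x | x ∈ I ∧ x ≠ 0} (by
        obtain ⟨x, hx, hx0⟩ := I.ne_bot_iff.1 hbot
        exact ⟨x, hx, hx0⟩)
    exact ⟨a, ha, fun x hx => not_lt.1 (h x hx)⟩
  obtain ⟨s, hs0⟩ := Γ.exists_proj_ne_zero ha0
  -- elements of `I` supported on the translate of the support of `a` that takes `s` to `k`
  let D : G → Submodule F A := fun k =>
    { carrier := {x | x ∈ I ∧ ∀ q, Γ.proj (k * s⁻¹ * q) x ≠ 0 → Γ.proj q a ≠ 0}
      add_mem' := fun {x y} hx hy => ⟨I.add_mem hx.1 hy.1, fun q hq => by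
        by_contra h
        rw [map_add, not_not.1 (fun h' => hx.2 q h' h), not_not.1 (fun h' => hy.2 q h' h),
          add_zero] at hq
        exact hq rfl⟩
      zero_mem' := ⟨I.zero_mem, fun q hq => absurd (map_zero _) hq⟩
      smul_mem' := fun r x hx => ⟨I.smul_mem r hx.1, fun q hq => hx.2 q fun h => hq (by
        rw [map_smul, h, smul_zero])⟩ }
  have hDmul : ∀ j k, ∀ y ∈ Γ.comp j, ∀ u ∈ D k, y * u ∈ D (j * k) ∧ u * y ∈ D (j * k) := by
    rintro j k y hy u ⟨huI, hu⟩
    refine ⟨⟨(hI y u huI).1, fun q hq => hu q fun h => hq ?_⟩,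
      ⟨(hI y u huI).2, fun q hq => hu q fun h => hq ?_⟩⟩
    · rw [mul_assoc j, mul_assoc j, Γ.proj_mul_of_mem_left hy, h, mul_zero]
    · rw [mul_assoc j, mul_assoc j, mul_comm j, Γ.proj_mul_of_mem_right hy, h, zero_mul]
  -- Such an `x` has support inside the translated support of `a` minus the point `k`, which
  -- corresponds to `s`. Minimality of the support of `a` forces `x = 0`.
  have hinj : ∀ k, ∀ x ∈ D k, Γ.proj k x = 0 → x = 0 := by
    rintro k x ⟨hxI, hx⟩ hk
    by_contra hx0
    refine absurd (hmin x ⟨hxI, hx0⟩) (not_le.2 ?_)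
    have himg : {g | Γ.proj g x ≠ 0} =
        (fun q => k * s⁻¹ * q) '' {q | Γ.proj (k * s⁻¹ * q) x ≠ 0} := by
      ext g
      constructor
      · intro hg
        exact ⟨s * k⁻¹ * g, by simpa [mul_assoc] using hg, by simp [mul_assoc]⟩
      · rintro ⟨q, hq, rfl⟩
        exact hq
    rw [himg, Set.ncard_image_of_injective _ (mul_right_injective _)]
    refine Set.ncard_lt_ncard ⟨fun q hq => hx q hq, fun h => ?_⟩ (Γ.finite_support a)
    exact h hs0 (by simpa using hk)
  have hsurj : ∀ k, (D k).map (Γ.proj k) = Γ.comp k := by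
    refine hs.eq_comp ?_ ?_ ?_
    · rintro k _ ⟨x, -, rfl⟩
      exact Γ.proj_mem k x
    · rintro j k y hy _ ⟨x, hx, rfl⟩
      exact ⟨⟨y * x, (hDmul j k y hy x hx).1, Γ.proj_mul_of_mem_left hy k x⟩,
        ⟨x * y, (hDmul j k y hy x hx).2, by
          rw [mul_comm j, Γ.proj_mul_of_mem_right hy]⟩⟩
    · exact ⟨s, Γ.proj s a, ⟨a, ⟨haI, fun q hq => by simpa using hq⟩, rfl⟩, hs0⟩
  -- An element of `D k` is determined by its component at `k`, which can be arbitrary. Sending that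
  -- component to the one at `t * s⁻¹ * k` defines a centroid element of degree `t * s⁻¹`. For `t ≠
  -- s` it must be zero, although it takes the component of `a` at `s` to the one at `t`.
  have hone : ∀ t, Γ.proj t a ≠ 0 → t = s := by
    by_contra! h
    obtain ⟨t, ht0, hts⟩ := h
    let π : ∀ k, D k →ₗ[F] Γ.comp k := fun k =>
      ((Γ.proj k).comp (D k).subtype).codRestrict (Γ.comp k) fun x => Γ.proj_mem k x
    have hπ : ∀ k, Function.Bijective (π k) := fun k => by
      constructor
      · refine (injective_iff_map_eq_zero _).2 fun x hx => Subtype.ext ?_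
        exact hinj k x x.2 (congrArg Subtype.val hx)
      · rintro ⟨y, hy⟩
        obtain ⟨x, hx, rfl⟩ : y ∈ (D k).map (Γ.proj k) := hsurj k ▸ hy
        exact ⟨⟨x, hx⟩, rfl⟩
    let φ : A →ₗ[F] A := Γ.lift fun k =>
      (Γ.proj (t * s⁻¹ * k)).comp
        ((D k).subtype.comp (LinearEquiv.ofBijective (π k) (hπ k)).symm.toLinearMap)
    have hφ : ∀ k, ∀ x ∈ D k, φ (Γ.proj k x) = Γ.proj (t * s⁻¹ * k) x := by
      intro k x hx
      have : (LinearEquiv.ofBijective (π k) (hπ k)).symm ⟨Γ.proj k x, Γ.proj_mem k x⟩ =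
          ⟨x, hx⟩ := by
        rw [LinearEquiv.symm_apply_eq]
        rfl
      simp only [φ, Γ.lift_of_mem _ (Γ.proj_mem k x), LinearMap.comp_apply, LinearEquiv.coe_coe,
        this, Submodule.subtype_apply]
    have hlift : ∀ k, ∀ u ∈ Γ.comp k, ∃ x ∈ D k, Γ.proj k x = u := fun k u hu => by
      have : u ∈ (D k).map (Γ.proj k) := hsurj k ▸ hu
      exact this
    refine ht0 ?_
    have hzero := hsupp (t * s⁻¹) (fun h => hts (mul_inv_eq_one.1 h)) φ
      (Γ.mem_centroid fun j k y hy z hz => ⟨?_, ?_⟩) fun k u hu => ?_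
    · have hφa := hφ s a ⟨haI, fun q hq => by simpa using hq⟩
      rw [hzero, inv_mul_cancel_right] at hφa
      exact hφa.symm
    · obtain ⟨x, hx, rfl⟩ := hlift k z hz
      rw [← Γ.proj_mul_of_mem_left hy, hφ _ _ (hDmul j k y hy x hx).1, hφ k x hx,
        ← Γ.proj_mul_of_mem_left hy, mul_left_comm]
    · obtain ⟨x, hx, rfl⟩ := hlift j y hy
      rw [← Γ.proj_mul_of_mem_right hz, mul_comm j k, hφ _ _ (hDmul k j z hz x hx).2, hφ j x hx,
        ← Γ.proj_mul_of_mem_right hz, mul_comm k j, mul_assoc (t * s⁻¹)]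
    · obtain ⟨x, hx, rfl⟩ := hlift k u hu
      rw [hφ k x hx]
      exact Γ.proj_mem _ x
  have ha : a ∈ Γ.comp s := Γ.mem_of_proj fun k hk => not_not.1 fun h => hk (hone k h)
  have hfull := hs.eq_comp (J := fun k => I ⊓ Γ.comp k) (fun k => inf_le_right)
    (fun j k y hy u hu => ⟨⟨(hI y u hu.1).1, Γ.mul_mem hy hu.2⟩,
      ⟨(hI y u hu.1).2, mul_comm j k ▸ Γ.mul_mem hu.2 hy⟩⟩) ⟨s, a, ⟨haI, ha⟩, ha0⟩
  rw [eq_top_iff, ← Γ.span]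
  exact iSup_le fun k => (hfull k) ▸ inf_le_left

/-- A graded-central algebra whose centroid has no nonzero homogeneous elements of nontrivial
degree is central. -/
theorem IsGradedCentral.isCentralAlg (hcen : IsGradedCentral F Γ)
    (hsupp : ∀ q : G, q ≠ 1 → ∀ c ∈ centroid F A,
      (∀ h, ∀ x ∈ Γ.comp h, c x ∈ Γ.comp (q * h)) → c = 0) : IsCentralAlg F A := by
  intro c hc
  refine hcen c hc fun k₀ x hx => Γ.mem_of_proj fun l hl => ?_
  -- The component of `c` of degree `l * k₀⁻¹`. It lies in the centroid even if `c` is not a finite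
  -- sum of such components.
  let d : A →ₗ[F] A := Γ.lift fun k => (Γ.proj (l * k₀⁻¹ * k)).comp (c.comp (Γ.comp k).subtype)
  have hd : ∀ k, ∀ x ∈ Γ.comp k, d x = Γ.proj (l * k₀⁻¹ * k) (c x) := fun k x hx => by
    simp only [d, Γ.lift_of_mem _ hx, LinearMap.comp_apply, Submodule.subtype_apply]
  have hzero := hsupp (l * k₀⁻¹) (fun h => hl (mul_inv_eq_one.1 h)) d
    (Γ.mem_centroid fun j k y hy z hz => ⟨?_, ?_⟩) fun k u hu => ?_
  · rw [← inv_mul_cancel_right l k₀, ← hd k₀ x hx, hzero, LinearMap.zero_apply]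
  · rw [hd _ _ (Γ.mul_mem hy hz), hd _ _ hz, (hc y z).1, ← Γ.proj_mul_of_mem_left hy,
      mul_left_comm]
  · rw [hd _ _ (Γ.mul_mem hy hz), hd _ _ hy, (hc y z).2, ← Γ.proj_mul_of_mem_right hz,
      mul_assoc (l * k₀⁻¹)]
  · rw [hd k u hu]
    exact Γ.proj_mem _ _

end GradedSimple

/-! ### Transfer of graded simplicity and centrality along a twisted cover. -/

section TwistedCover

variable {F : Type*} [Field F] {B : Type*} [NonUnitalNonAssocRing B] [Module F B]
  {A : Type*} [NonUnitalNonAssocRing A] [Module F A]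
  {G Q : Type*} [CommGroup G] [CommGroup Q]

/-- A linear map `B → A` that identifies each `B_g` with `A_{π(g)}` and is multiplicative up to
a symmetric 2-cocycle with values in `Fˣ`. -/
structure TwistedCover (Γ : Grading F B G) (Δ : Grading F A Q) (π : G →* Q) where
  toLin : B →ₗ[F] A
  cocycle : G → G → F
  cocycle_ne_zero : ∀ g h, cocycle g h ≠ 0
  cocycle_comm : ∀ g h, cocycle g h = cocycle h g
  cocycle_mul : ∀ j g k,
    cocycle j (g * k) * cocycle g k = cocycle j k * cocycle g (j * k)
  map_mem : ∀ {g x}, x ∈ Γ.comp g → toLin x ∈ Δ.comp (π g)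
  eq_zero : ∀ {g x}, x ∈ Γ.comp g → toLin x = 0 → x = 0
  exists_eq : ∀ {g y}, y ∈ Δ.comp (π g) → ∃ x ∈ Γ.comp g, toLin x = y
  toLin_mul : ∀ {g h x y}, x ∈ Γ.comp g → y ∈ Γ.comp h →
    toLin x * toLin y = cocycle g h • toLin (x * y)

namespace TwistedCover

variable {Γ : Grading F B G} {Δ : Grading F A Q} {π : G →* Q} (p : TwistedCover Γ Δ π)
include p

/-- A graded ideal pulls back to a stable family of subspaces of the components of `B`: the cocycle
values are nonzero scalars, which ideals do not see. -/
theorem isGradedSimple (hπ : Function.Surjective π) (hs : IsGradedSimple F Γ) :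
    IsGradedSimple F Δ := by
  constructor
  · obtain ⟨g, k, x, hx, y, hy, hxy⟩ := Γ.exists_homogeneous_mul_ne_zero hs.1
    refine ⟨p.toLin x, p.toLin y, ?_⟩
    rw [p.toLin_mul hx hy]
    exact smul_ne_zero (p.cocycle_ne_zero g k) fun h => hxy (p.eq_zero (Γ.mul_mem hx hy) h)
  · intro I hI hgr
    by_cases h : ∃ g, ∃ x ∈ Γ.comp g ⊓ I.comap p.toLin, x ≠ 0
    · right
      have hfull := hs.eq_comp (J := fun g => Γ.comp g ⊓ I.comap p.toLin)
        (fun g => inf_le_left) (fun j k y hy u hu => ?_) h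
      · rw [eq_top_iff, ← Δ.span]
        refine iSup_le fun q y hy => ?_
        obtain ⟨g, rfl⟩ := hπ q
        obtain ⟨x, hx, rfl⟩ := p.exists_eq hy
        exact ((hfull g).symm.le hx).2
      · refine ⟨⟨Γ.mul_mem hy hu.1, ?_⟩, ⟨mul_comm j k ▸ Γ.mul_mem hu.1 hy, ?_⟩⟩
        · change p.toLin (y * u) ∈ I
          rw [← Submodule.smul_mem_iff _ (p.cocycle_ne_zero j k),
            ← p.toLin_mul hy hu.1]
          exact (hI _ _ hu.2).1
        · change p.toLin (u * y) ∈ I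
          rw [← Submodule.smul_mem_iff _ (p.cocycle_ne_zero k j),
            ← p.toLin_mul hu.1 hy]
          exact (hI _ _ hu.2).2
    · left
      rw [hgr, iSup_eq_bot]
      intro q
      rw [eq_bot_iff]
      rintro y ⟨hyI, hy⟩
      obtain ⟨g, rfl⟩ := hπ q
      obtain ⟨x, hx, rfl⟩ := p.exists_eq hy
      by_contra hne
      refine h ⟨g, x, ⟨hx, hyI⟩, ?_⟩
      rintro rfl
      exact hne (by simp)

variable [IsScalarTower F A A] [SMulCommClass F A A] [IsScalarTower F B B] [SMulCommClass F B B]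

/-- Homogeneous elements of the centroid lift along a twisted cover. -/
theorem exists_centroid_lift {g : G} {c : Module.End F A} (hc : c ∈ centroid F A)
    (hd : ∀ q, ∀ y ∈ Δ.comp q, c y ∈ Δ.comp (π g * q)) :
    ∃ d ∈ centroid F B, (∀ k, ∀ x ∈ Γ.comp k, d x ∈ Γ.comp (g * k)) ∧
      ∀ k, ∀ x ∈ Γ.comp k, p.cocycle g k • p.toLin (d x) = c (p.toLin x) := by
  let r : ∀ k, Γ.comp k →ₗ[F] Δ.comp (π k) := fun k =>
    (p.toLin.comp (Γ.comp k).subtype).codRestrict _ fun x => p.map_mem x.2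
  have hr : ∀ k, Function.Bijective (r k) := fun k => by
    constructor
    · refine (injective_iff_map_eq_zero _).2 fun x hx => Subtype.ext ?_
      exact p.eq_zero x.2 (congrArg Subtype.val hx)
    · rintro ⟨y, hy⟩
      obtain ⟨x, hx, rfl⟩ := p.exists_eq hy
      exact ⟨⟨x, hx⟩, rfl⟩
  let e : ∀ k, Γ.comp k ≃ₗ[F] Δ.comp (π k) := fun k => LinearEquiv.ofBijective (r k) (hr k)
  have he : ∀ k (y : Δ.comp (π k)), p.toLin ((e k).symm y) = y := fun k y =>
    congrArg Subtype.val ((e k).apply_symm_apply y)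
  -- Transporting `c` unchanged would fail to commute with multiplication by cocycle factors;
  -- division by `cocycle g k` absorbs them, and `cocycle_mul` is exactly the identity required.
  let s : ∀ k, Γ.comp k →ₗ[F] Δ.comp (π (g * k)) := fun k =>
    ((p.cocycle g k)⁻¹ • c.comp (p.toLin.comp (Γ.comp k).subtype)).codRestrict _ fun x => by
      rw [map_mul]
      exact Submodule.smul_mem _ _ (hd _ _ (p.map_mem x.2))
  let d : Module.End F B := Γ.lift fun k =>
    (Γ.comp (g * k)).subtype.comp ((e (g * k)).symm.toLinearMap.comp (s k))
  have hdx : ∀ k, ∀ x (hx : x ∈ Γ.comp k), d x = (e (g * k)).symm (s k ⟨x, hx⟩) :=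
    fun k x hx => Γ.lift_of_mem _ hx
  have hdeg : ∀ k, ∀ x ∈ Γ.comp k, d x ∈ Γ.comp (g * k) := fun k x hx => by
    rw [hdx k x hx]
    exact Submodule.coe_mem _
  have hpd : ∀ k, ∀ x ∈ Γ.comp k, p.cocycle g k • p.toLin (d x) = c (p.toLin x) :=
    fun k x hx => by
      rw [hdx k x hx, he]
      exact smul_inv_smul₀ (p.cocycle_ne_zero g k) _
  have hinj : ∀ {k x y}, x ∈ Γ.comp k → y ∈ Γ.comp k → p.toLin x = p.toLin y → x = y :=
    fun {k x y} hx hy h => sub_eq_zero.1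
      (p.eq_zero (Submodule.sub_mem _ hx hy) (by rw [map_sub, h, sub_self]))
  have hleft : ∀ j k, ∀ x ∈ Γ.comp j, ∀ y ∈ Γ.comp k, d (x * y) = x * d y :=
    fun j k x hx y hy => by
      have hxy := Γ.mul_mem hx hy
      refine hinj (hdeg _ _ hxy) (mul_left_comm j g k ▸ Γ.mul_mem hx (hdeg _ _ hy)) ?_
      refine smul_right_injective A
        (mul_ne_zero (p.cocycle_ne_zero j k) (p.cocycle_ne_zero g (j * k))) ?_
      dsimp only
      rw [mul_smul, hpd _ _ hxy, ← map_smul, ← p.toLin_mul hx hy, (hc _ _).1, ← hpd _ _ hy,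
        mul_smul_comm, p.toLin_mul hx (hdeg _ _ hy), ← mul_smul, ← p.cocycle_mul, mul_comm]
  have hright : ∀ j k, ∀ x ∈ Γ.comp j, ∀ y ∈ Γ.comp k, d (x * y) = d x * y :=
    fun j k x hx y hy => by
      have hxy := Γ.mul_mem hx hy
      refine hinj (hdeg _ _ hxy) (mul_assoc g j k ▸ Γ.mul_mem (hdeg _ _ hx) hy) ?_
      refine smul_right_injective A
        (mul_ne_zero (p.cocycle_ne_zero j k) (p.cocycle_ne_zero g (j * k))) ?_
      dsimp only
      rw [mul_smul, hpd _ _ hxy, ← map_smul, ← p.toLin_mul hx hy, (hc _ _).2, ← hpd _ _ hx,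
        smul_mul_assoc, p.toLin_mul (hdeg _ _ hx) hy, ← mul_smul, p.cocycle_comm j k, mul_comm j k,
        ← p.cocycle_mul, mul_comm, p.cocycle_comm k]
  exact ⟨d, Γ.mem_centroid fun j k x hx y hy => ⟨hleft j k x hx y hy, hright j k x hx y hy⟩,
    hdeg, hpd⟩

theorem centroid_eq_zero (hπ : Function.Surjective π)
    (hker : ∀ g ∈ centroidSupport F Γ, π g = 1) (q : Q) (hq : q ≠ 1) (c : Module.End F A)
    (hc : c ∈ centroid F A) (hd : ∀ h, ∀ y ∈ Δ.comp h, c y ∈ Δ.comp (q * h)) : c = 0 := by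
  obtain ⟨g, rfl⟩ := hπ q
  obtain ⟨d, hdc, hdeg, hpd⟩ := p.exists_centroid_lift hc hd
  have hbot : centroidComp F Γ g = ⊥ := by
    by_contra h
    exact hq (hker g h)
  have hd0 : d = 0 := by
    have hmem : (⟨d, hdc⟩ : centroid F B) ∈ centroidComp F Γ g := hdeg
    rw [hbot, Submodule.mem_bot] at hmem
    exact congrArg Subtype.val hmem
  refine Δ.hom_ext fun q y hy => ?_
  obtain ⟨k, rfl⟩ := hπ q
  obtain ⟨x, hx, rfl⟩ := p.exists_eq hy
  rw [← hpd k x hx, hd0]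
  simp

/-- A lift of degree `1` is a scalar on `B`. The rescaling factor `cocycle 1 k` does not depend on
`k`, so the original operator is a scalar too. -/
theorem isGradedCentral (hπ : Function.Surjective π) (hcen : IsGradedCentral F Γ) :
    IsGradedCentral F Δ := by
  intro c hc hd
  obtain ⟨d, hdc, hdeg, hpd⟩ := p.exists_centroid_lift (g := 1) hc
    (fun q y hy => by rw [map_one, one_mul]; exact hd q y hy)
  obtain ⟨r, hr⟩ := hcen d hdc fun k x hx => by simpa using hdeg k x hx
  have hone : ∀ k, p.cocycle 1 k = p.cocycle 1 1 := fun k => by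
    have := p.cocycle_mul k 1 1
    rw [one_mul, mul_one, p.cocycle_comm k 1] at this
    exact (mul_left_cancel₀ (p.cocycle_ne_zero 1 k) this).symm
  refine ⟨p.cocycle 1 1 * r, fun y => ?_⟩
  refine Δ.induction y (fun q y hy => ?_) (by simp) fun y z hy hz => ?_
  · obtain ⟨k, rfl⟩ := hπ q
    obtain ⟨x, hx, rfl⟩ := p.exists_eq hy
    rw [← hpd k x hx, hr, map_smul, hone, mul_smul]
  · rw [map_add, hy, hz, smul_add]

end TwistedCover

end TwistedCover

/-! ### Construction of the algebra `A` from coset representatives. -/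

section BilinAlg

variable {F : Type*} [Field F] {M : Type*} [AddCommGroup M] [Module F M]

/-- The vector space `M` with the multiplication given by a bilinear map. -/
def BilinAlg (_ : M →ₗ[F] M →ₗ[F] M) : Type _ := M

variable (μ : M →ₗ[F] M →ₗ[F] M)

instance : AddCommGroup (BilinAlg μ) := inferInstanceAs (AddCommGroup M)

instance : NonUnitalNonAssocRing (BilinAlg μ) where
  mul x y := μ x y
  left_distrib x y z := map_add (μ x) y z
  right_distrib x y z := LinearMap.map_add₂ μ x y z
  zero_mul x := LinearMap.map_zero₂ μ x
  mul_zero x := map_zero (μ x)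

instance : Module F (BilinAlg μ) := inferInstanceAs (Module F M)

instance : IsScalarTower F (BilinAlg μ) (BilinAlg μ) where
  smul_assoc r x y := LinearMap.map_smul₂ μ r x y

instance : SMulCommClass F (BilinAlg μ) (BilinAlg μ) where
  smul_comm r x y := ((μ x).map_smul r y).symm

end BilinAlg

section Construction

variable {F : Type*} [Field F] {B : Type u} [NonUnitalNonAssocRing B] [Module F B]
  {G Q : Type*} [CommGroup G] [CommGroup Q]

/-- A twisted cover can be constructed from a linear map that identifies each `B_g` with the
component of a chosen representative of `π(g)`, compatibly with the twisted multiplication. -/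
theorem exists_twistedCover [IsScalarTower F B B] [SMulCommClass F B B]
    (Γ : Grading F B G) (π : G →* Q) (σ : Q → G) (hσ : ∀ q, π (σ q) = q)
    (f : G → G → F) (hf0 : ∀ g h, f g h ≠ 0) (hfc : ∀ g h, f g h = f h g)
    (hfm : ∀ j g k, f j (g * k) * f g k = f j k * f g (j * k))
    (P : B →ₗ[F] B) (hPmem : ∀ g, ∀ x ∈ Γ.comp g, P x ∈ Γ.comp (σ (π g)))
    (hPinj : ∀ g, ∀ x ∈ Γ.comp g, P x = 0 → x = 0)
    (hPsurj : ∀ g, ∀ y ∈ Γ.comp (σ (π g)), ∃ x ∈ Γ.comp g, P x = y)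
    (hPmul : ∀ g h, ∀ x ∈ Γ.comp g, ∀ y ∈ Γ.comp h,
      f (σ (π g)) (σ (π h)) • P (P x * P y) = f g h • P (x * y)) :
    ∃ (A : Type u) (_ : NonUnitalNonAssocRing A) (_ : Module F A) (_ : IsScalarTower F A A)
      (_ : SMulCommClass F A A) (Δ : Grading F A Q) (p : TwistedCover Γ Δ π), p.cocycle = f := by
  let m : B →ₗ[F] B →ₗ[F] B := Γ.lift fun g =>
    (Γ.lift fun h => (f g h • (LinearMap.mul F B).flip.comp (Γ.comp h).subtype)).flip.comp
      (Γ.comp g).subtype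
  have hm : ∀ g h, ∀ x ∈ Γ.comp g, ∀ y ∈ Γ.comp h, m x y = f g h • (x * y) :=
    fun g h x hx y hy => by
      simp only [m, Γ.lift_of_mem _ hx, LinearMap.comp_apply, LinearMap.flip_apply,
        Γ.lift_of_mem _ hy, LinearMap.smul_apply, Submodule.subtype_apply,
        LinearMap.mul_apply_apply]
  -- The range of `P` is the sum of the components at the representatives `σ q`. A product of
  -- elements of degrees `σ q` and `σ r` has degree `σ q * σ r`, and `P` brings it back to `σ (q *
  -- r)`.
  let μ : LinearMap.range P →ₗ[F] LinearMap.range P →ₗ[F] LinearMap.range P :=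
    (m.compl₁₂ (LinearMap.range P).subtype (LinearMap.range P).subtype).compr₂ P.rangeRestrict
  let ι : BilinAlg μ →ₗ[F] B := (LinearMap.range P).subtype
  have hι : Function.Injective ι := Subtype.val_injective
  have hιmul : ∀ a b : BilinAlg μ, ι (a * b) = P (m (ι a) (ι b)) := fun a b => rfl
  let p₀ : B →ₗ[F] BilinAlg μ := P.rangeRestrict
  have hp₀ : ∀ x, ι (p₀ x) = P x := fun x => rfl
  let Δ : Grading F (BilinAlg μ) Q :=
    { comp := fun q => (Γ.comp (σ q)).comap ι
      independent := by
        intro q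
        refine Submodule.disjoint_def.2 fun a ha ha' => hι ?_
        have hle : ⨆ r, ⨆ (_ : r ≠ q), (Γ.comp (σ r)).comap ι ≤
            (⨆ k, ⨆ (_ : k ≠ σ q), Γ.comp k).comap ι :=
          iSup₂_le fun r hr => Submodule.comap_mono
            (le_iSup₂_of_le (σ r) (fun h => hr (by rw [← hσ r, h, hσ])) le_rfl)
        rw [map_zero]
        exact Submodule.disjoint_def.1 (Γ.independent (σ q)) _ ha (hle ha')
      span := by
        rw [eq_top_iff]
        rintro a -
        obtain ⟨b, rfl⟩ : ∃ b, p₀ b = a := P.surjective_rangeRestrict a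
        refine Γ.induction b (fun g x hx => ?_) (by simp) fun x y hx hy => ?_
        · exact Submodule.mem_iSup_of_mem (π g) (hPmem g x hx)
        · rw [map_add]
          exact Submodule.add_mem _ hx hy
      mul_mem := by
        intro q r a b ha hb
        change ι (a * b) ∈ Γ.comp (σ (q * r))
        rw [hιmul, hm _ _ _ ha _ hb, map_smul]
        refine Submodule.smul_mem _ _ ?_
        have := hPmem _ _ (Γ.mul_mem ha hb)
        rwa [map_mul, hσ, hσ] at this }
  refine ⟨BilinAlg μ, inferInstance, inferInstance, inferInstance, inferInstance, Δ,
    { toLin := p₀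
      cocycle := f
      cocycle_ne_zero := hf0
      cocycle_comm := hfc
      cocycle_mul := hfm
      map_mem := fun {g x} hx => hPmem g x hx
      eq_zero := fun {g x} hx h => hPinj g x hx (congrArg ι h)
      exists_eq := fun {g y} hy => by
        obtain ⟨x, hx, h⟩ := hPsurj g _ hy
        exact ⟨x, hx, hι h⟩
      toLin_mul := fun {g h x y} hx hy => hι ?_ }, rfl⟩
  rw [hιmul, map_smul, hp₀, hp₀, hp₀, hm _ _ _ (hPmem g x hx) _ (hPmem h y hy), map_smul]
  exact hPmul g h x hx y hy

end Construction

/-! ### From units of the centroid to a twisted cover. -/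

section CentroidSection

variable {F : Type*} [Field F] {K : Type*} [Field K] [Algebra F K] (conj : K ≃ₐ[F] K)
  {G : Type*} [CommGroup G]

/-- The nonzero homogeneous elements of the loop algebra `L_π^χ(F)`, as pairs of a degree
`h ∈ H` and a scalar `z` fixed by `z ↦ conj z * χ h`. -/
def fixedUnits (H : Subgroup G) (χ : G →* unitCircle conj) : Subgroup (G × Kˣ) where
  carrier := {l | l.1 ∈ H ∧ (l.2 : K) = conj (l.2 : K) * ((χ l.1 : Kˣ) : K)}
  one_mem' := ⟨H.one_mem, by simp⟩
  mul_mem' {a b} ha hb := ⟨H.mul_mem ha.1 hb.1, by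
    simp only [Prod.snd_mul, Prod.fst_mul, Units.val_mul, map_mul, Subgroup.coe_mul]
    rw [mul_mul_mul_comm, ← ha.2, ← hb.2]⟩
  inv_mem' {a} ha := ⟨H.inv_mem ha.1, by
    simp only [Prod.snd_inv, Prod.fst_inv, Units.val_inv_eq_inv_val, map_inv, map_inv₀,
      Subgroup.coe_inv]
    rw [← mul_inv, ← ha.2]⟩

variable {conj} {B : Type u} [NonUnitalNonAssocRing B] [Module F B]
  [IsScalarTower F B B] [SMulCommClass F B B]

/-- An identification of the homogeneous units of `L_π^χ(F)` with homogeneous elements of the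
centroid of `B`. -/
structure CentroidSection (Γ : Grading F B G) (H : Subgroup G) (χ : G →* unitCircle conj) where
  toHom : fixedUnits conj H χ →* centroid F B
  mem_comp : ∀ l, toHom l ∈ centroidComp F Γ l.1.1
  eq_algebraMap : ∀ l : fixedUnits conj H χ, l.1.1 = 1 → ∀ r : F,
    algebraMap F K r = (l.1.2 : K) → toHom l = algebraMap F _ r

/-- The quotient `l * l'⁻¹` has trivial degree and scalar part `r`, so it acts as `r`. -/
theorem CentroidSection.eq_smul {Γ : Grading F B G} {H : Subgroup G} {χ : G →* unitCircle conj}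
    (τ : CentroidSection Γ H χ) {l l' : fixedUnits conj H χ} (h₁ : l.1.1 = l'.1.1) {r : F}
    (h₂ : (l.1.2 : K) = algebraMap F K r * (l'.1.2 : K)) : τ.toHom l = r • τ.toHom l' := by
  have h := τ.eq_algebraMap (l * l'⁻¹) (by simp [h₁]) r (by
    simp only [Subgroup.coe_mul, Subgroup.coe_inv, Prod.snd_mul, Prod.snd_inv, Units.val_mul, h₂]
    simp)
  rw [Algebra.smul_def, ← h, ← map_mul, inv_mul_cancel_right]

variable {i : K} [CharZero F]

/-- If the centroid of `B` contains `L_π^χ(F)` then `B` is a twisted cover of a `G/H`-graded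
algebra, for the cocycle defined by scalars that trivialize `χ⁻¹`. -/
theorem CentroidSection.exists_twistedCover {Γ : Grading F B G} {H : Subgroup G}
    {χ : G →* unitCircle conj} (τ : CentroidSection Γ H χ) (hi : i * i = -1)
    (hK : Algebra.adjoin F {i} = ⊤) (hconj : conj i = -i) :
    ∃ (A : Type u) (_ : NonUnitalNonAssocRing A) (_ : Module F A) (_ : IsScalarTower F A A)
      (_ : SMulCommClass F A A) (Δ : Grading F A (G ⧸ H))
      (p : TwistedCover Γ Δ (QuotientGroup.mk' H)) (w : G → Kˣ),
      (∀ g, (w g : K) = conj (w g : K) * ((χ g⁻¹ : Kˣ) : K)) ∧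
      ∀ g h, algebraMap F K (p.cocycle g h) = w g * w h / w (g * h) := by
  -- The inverse character is trivialized, so that `(w g)⁻¹ g` is a fixed point of the action
  -- twisted by `χ`.
  choose w hw using fun g : G => exists_unit_eq_conj_mul (F := F) hi hconj (χ g⁻¹)
  have hχ : ∀ g, ((χ g⁻¹ : Kˣ) : K) = (((χ g : Kˣ) : K))⁻¹ := fun g => by
    simp
  have hcw : ∀ g, conj (w g : K) = w g * ((χ g : Kˣ) : K) := fun g => by
    have h := hw g
    rw [hχ] at h
    exact ((eq_mul_inv_iff_mul_eq₀ (Units.ne_zero _)).1 h).symm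
  have hf : ∀ g h, ∃ r : F, algebraMap F K r = w g * w h / w (g * h) := fun g h => by
    refine exists_algebraMap_eq_of_conj_eq hi hK hconj ?_
    simp only [map_div₀, map_mul, hcw, Subgroup.coe_mul, Units.val_mul]
    field_simp
  choose f hf using hf
  have hinj := (algebraMap F K).injective
  let σ : G ⧸ H → G := Quotient.out
  have hσ : ∀ q, QuotientGroup.mk' H (σ q) = q := fun q => Quotient.out_eq q
  -- The unit that moves `B_g` to `B_k`. Its scalar `w g / w k` satisfies the fixed-point condition
  -- in degree `k * g⁻¹`, and it makes `P` compatible with the product twisted by `f`.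
  let t : ∀ g k : G, g⁻¹ * k ∈ H → fixedUnits conj H χ := fun g k hgk =>
    ⟨(k * g⁻¹, w g / w k), mul_comm k g⁻¹ ▸ hgk, by
      simp only [Units.val_div_eq_div_val, map_div₀, hcw, map_mul, Subgroup.coe_mul, Units.val_mul,
        hχ]
      field_simp⟩
  have hmem : ∀ g, g⁻¹ * σ (QuotientGroup.mk' H g) ∈ H := fun g =>
    QuotientGroup.eq.1 (hσ (QuotientGroup.mk' H g)).symm
  let P : B →ₗ[F] B := Γ.lift fun g =>
    ((τ.toHom (t g _ (hmem g)) : centroid F B) : Module.End F B).comp (Γ.comp g).subtype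
  have hP : ∀ g, ∀ x ∈ Γ.comp g,
      P x = ((τ.toHom (t g _ (hmem g)) : centroid F B) : Module.End F B) x := fun g x hx =>
    Γ.lift_of_mem _ hx
  have hinv : ∀ l x, ((τ.toHom l⁻¹ : centroid F B) : Module.End F B)
      (((τ.toHom l : centroid F B) : Module.End F B) x) = x := fun l x => by
    rw [← Module.End.mul_apply, ← Subalgebra.coe_mul, ← map_mul, inv_mul_cancel, map_one]
    rfl
  have hf0 : ∀ g h, f g h ≠ 0 := fun g h h0 => by
    have := hf g h
    rw [h0, map_zero] at this
    simp [eq_comm] at this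
  have hfc : ∀ g h, f g h = f h g := fun g h => hinj <| by
    rw [hf, hf, mul_comm h g, mul_comm (w h : K)]
  have hfm : ∀ j g k, f j (g * k) * f g k = f j k * f g (j * k) := fun j g k => hinj <| by
    rw [map_mul, map_mul, hf, hf, hf, hf, mul_left_comm j g k]
    field_simp
  have hPmem : ∀ g, ∀ x ∈ Γ.comp g, P x ∈ Γ.comp (σ (QuotientGroup.mk' H g)) := fun g x hx => by
    rw [hP g x hx]
    simpa [t] using τ.mem_comp (t g _ (hmem g)) g x hx
  have hPinj : ∀ g, ∀ x ∈ Γ.comp g, P x = 0 → x = 0 := fun g x hx h0 => by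
    rw [hP g x hx] at h0
    rw [← hinv (t g _ (hmem g)) x, h0, map_zero]
  have hPsurj : ∀ g, ∀ y ∈ Γ.comp (σ (QuotientGroup.mk' H g)), ∃ x ∈ Γ.comp g, P x = y :=
      fun g y hy => by
    refine ⟨((τ.toHom (t g _ (hmem g))⁻¹ : centroid F B) : Module.End F B) y, ?_, ?_⟩
    · simpa [t] using τ.mem_comp (t g _ (hmem g))⁻¹ _ y hy
    · rw [hP g]
      · simpa using hinv (t g _ (hmem g))⁻¹ y
      · simpa [t] using τ.mem_comp (t g _ (hmem g))⁻¹ _ y hy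
  have hPmul : ∀ g h, ∀ x ∈ Γ.comp g, ∀ y ∈ Γ.comp h,
      f (σ (QuotientGroup.mk' H g)) (σ (QuotientGroup.mk' H h)) • P (P x * P y) =
        f g h • P (x * y) := fun g h x hx y hy => by
    have hprod : P x * P y = ((τ.toHom (t g _ (hmem g) * t h _ (hmem h)) : centroid F B) :
        Module.End F B) (x * y) := by
      rw [hP g x hx, hP h y hy, ← ((τ.toHom (t g _ (hmem g))).2 x _).2,
        ← ((τ.toHom (t h _ (hmem h))).2 x y).1, map_mul τ.toHom]
      rfl
    have hdeg : P x * P y ∈ Γ.comp (σ (QuotientGroup.mk' H g) * σ (QuotientGroup.mk' H h)) := by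
      rw [hP g x hx, hP h y hy]
      refine Γ.mul_mem ?_ ?_
      · simpa [t] using τ.mem_comp (t g _ (hmem g)) g x hx
      · simpa [t] using τ.mem_comp (t h _ (hmem h)) h y hy
    rw [hP _ _ hdeg, hP _ _ (Γ.mul_mem hx hy), hprod, ← Module.End.mul_apply, ← Subalgebra.coe_mul,
      ← map_mul]
    set l := t _ _ (hmem (σ (QuotientGroup.mk' H g) * σ (QuotientGroup.mk' H h))) *
      (t g _ (hmem g) * t h _ (hmem h)) with hl
    have hrep : σ (QuotientGroup.mk' H (σ (QuotientGroup.mk' H g) * σ (QuotientGroup.mk' H h))) =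
        σ (QuotientGroup.mk' H (g * h)) := by
      rw [map_mul, hσ, hσ, map_mul]
    -- Both sides apply a unit of the same degree to `x * y`. The quotient of their scalars is the
    -- quotient of the coboundary of `w` at `(g, h)` by the one at the representatives.
    have := τ.eq_smul (l := l) (l' := t (g * h) _ (hmem (g * h)))
      (r := f g h / f (σ (QuotientGroup.mk' H g)) (σ (QuotientGroup.mk' H h))) ?_ ?_
    · rw [this, Subalgebra.coe_smul, LinearMap.smul_apply, smul_smul, mul_div_cancel₀ _ (hf0 _ _)]
    · simp only [l, t, Subgroup.coe_mul, Prod.fst_mul, hrep, mul_inv]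
      rw [mul_mul_mul_comm _ g⁻¹ _ h⁻¹, mul_assoc, ← mul_inv (σ _) (σ _),
        inv_mul_cancel_left]
    · simp only [l, t, Subgroup.coe_mul, Prod.snd_mul, hrep, map_div₀, hf, Units.val_mul,
        Units.val_div_eq_div_val]
      field_simp
  obtain ⟨A, i₁, i₂, i₃, i₄, Δ, p, hp⟩ := GradedLoop.exists_twistedCover Γ (QuotientGroup.mk' H) σ hσ
    f hf0 hfc hfm P hPmem hPinj hPsurj hPmul
  exact ⟨A, i₁, i₂, i₃, i₄, Δ, p, w, hw, fun g h => hp ▸ hf g h⟩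

end CentroidSection

/-! ### The isomorphism with the loop algebra. -/

section LoopIso

variable {F : Type*} [Field F] {K : Type*} [Field K] [Algebra F K] {conj : K ≃ₐ[F] K}
  {G : Type*}

/-- The linear map `A ⊗ K G → A` that applies a linear functional to the coefficient at `g`. -/
noncomputable def coeffMap (A : Type*) [AddCommGroup A] [Module F A] (g : G) (v : K →ₗ[F] F) :
    A ⊗[F] MonoidAlgebra K G →ₗ[F] A :=
  (TensorProduct.rid F A).toLinearMap.comp ((v.comp
    ((Finsupp.lapply g).comp (MonoidAlgebra.coeffLinearEquiv F).toLinearMap)).lTensor A)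

theorem coeffMap_tmul_single {A : Type*} [AddCommGroup A] [Module F A] (g : G) (v : K →ₗ[F] F)
    (a : A) (z : K) : coeffMap A g v (a ⊗ₜ[F] MonoidAlgebra.single g z) = v z • a := by
  simp [coeffMap]

theorem coeffMap_tmul_single_of_ne {A : Type*} [AddCommGroup A] [Module F A] {g k : G}
    (h : k ≠ g) (v : K →ₗ[F] F) (a : A) (z : K) :
    coeffMap A g v (a ⊗ₜ[F] MonoidAlgebra.single k z) = 0 := by
  simp [coeffMap, h]

theorem exists_functional_eq_one {v : K} (hv : v ≠ 0) : ∃ φ : K →ₗ[F] F, φ v = 1 := by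
  obtain ⟨φ, hφ⟩ := LinearMap.exists_leftInverse_of_injective (LinearMap.toSpanSingleton F K v)
    (LinearMap.ker_toSpanSingleton F hv)
  exact ⟨φ, by simpa using DFunLike.congr_fun hφ 1⟩

variable [CommGroup G] {B : Type*} [NonUnitalNonAssocRing B] [Module F B]
  {A : Type*} [NonUnitalNonAssocRing A] [Module F A] [IsScalarTower F A A]
  [SMulCommClass F A A] {i : K} [CharZero F]

/-- The map `x ↦ p x ⊗ (w g)⁻¹ g` on `B_g` has fixed points as values by the choice of `w`. It is
multiplicative because the cocycle of `p` is the coboundary of `w`. -/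
theorem TwistedCover.gradedIso {Γ : Grading F B G} {H : Subgroup G} {Δ : Grading F A (G ⧸ H)}
    (p : TwistedCover Γ Δ (QuotientGroup.mk' H)) {χ : G →* unitCircle conj} (hi : i * i = -1)
    (hK : Algebra.adjoin F {i} = ⊤) (hconj : conj i = -i) {w : G → Kˣ}
    (hw : ∀ g, (w g : K) = conj (w g : K) * ((χ g⁻¹ : Kˣ) : K))
    (hp : ∀ g h, algebraMap F K (p.cocycle g h) = w g * w h / w (g * h)) :
    GradedIso F Γ.comp (loopComp conj Δ χ) := by
  have hcw : ∀ g, conj (w g : K) = w g * ((χ g : Kˣ) : K) := fun g => by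
    have h := hw g
    rw [map_inv, Subgroup.coe_inv, Units.val_inv_eq_inv_val] at h
    exact ((eq_mul_inv_iff_mul_eq₀ (Units.ne_zero _)).1 h).symm
  let Φ : B →ₗ[F] A ⊗[F] MonoidAlgebra K G := Γ.lift fun g =>
    ((TensorProduct.mk F A (MonoidAlgebra K G)).flip (MonoidAlgebra.single g (w g : K)⁻¹)).comp
      (p.toLin.comp (Γ.comp g).subtype)
  have hΦ : ∀ g, ∀ x ∈ Γ.comp g, Φ x = p.toLin x ⊗ₜ[F] MonoidAlgebra.single g (w g : K)⁻¹ :=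
    fun g x hx => Γ.lift_of_mem _ hx
  have hΦext : ∀ g, ∀ x ∈ Γ.comp g, Φ x ∈ loopCompExt K Δ g := fun g x hx => by
    rw [hΦ g x hx]
    exact Submodule.subset_span ⟨_, p.map_mem hx, _, rfl⟩
  have hΦmem : ∀ x, Φ x ∈ loopAlg conj Δ χ := fun x => by
    refine Γ.induction x (fun g x hx => ⟨Submodule.mem_iSup_of_mem g (hΦext g x hx), ?_⟩)
      (by rw [map_zero]; exact zero_mem _) fun x y hx hy => by rw [map_add]; exact add_mem hx hy
    rw [hΦ g x hx, LinearMap.lTensor_tmul, AlgHom.toLinearMap_apply, twistGroupAlg_single,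
      map_inv₀, hcw]
    congr 2
    field_simp
  have hΦmul : ∀ x y, Φ (x * y) = Φ x * Φ y := fun x y => by
    refine Γ.induction x (fun g x hx => ?_) (by simp) fun a b ha hb => ?_
    · refine Γ.induction y (fun h y hy => ?_) (by simp) fun a b ha hb => ?_
      · rw [hΦ _ _ hx, hΦ _ _ hy, hΦ _ _ (Γ.mul_mem hx hy), Algebra.TensorProduct.tmul_mul_tmul,
          MonoidAlgebra.single_mul_single, p.toLin_mul hx hy, TensorProduct.smul_tmul,
          MonoidAlgebra.smul_single, Algebra.smul_def, hp]
        congr 2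
        field_simp
      · rw [mul_add, map_add, ha, hb, map_add, mul_add]
    · rw [add_mul, map_add, ha, hb, map_add, add_mul]
  choose v hv using fun g => exists_functional_eq_one (F := F) (inv_ne_zero (w g).ne_zero)
  have hcoeff : ∀ g x, coeffMap A g (v g) (Φ x) = p.toLin (Γ.proj g x) := fun g x => by
    refine Γ.induction x (fun k x hx => ?_) (by simp) fun a b ha hb => by
      simp only [map_add, ha, hb]
    by_cases h : k = g
    · subst h
      rw [hΦ _ _ hx, coeffMap_tmul_single, hv, one_smul, Γ.proj_of_mem hx]
    · rw [hΦ _ _ hx, coeffMap_tmul_single_of_ne h, Γ.proj_of_mem_of_ne hx h, map_zero]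
  have hzero : ∀ g x, coeffMap A g (v g) (Φ x) = 0 → Γ.proj g x = 0 := fun g x h =>
    p.eq_zero (Γ.proj_mem g x) ((hcoeff g x).symm.trans h)
  -- Surjectivity by averaging: on a fixed point `y` this sum is `2 • y`, and 2 is invertible.
  have hfix : ∀ y ∈ ⨆ g, loopCompExt K Δ g,
      y + (twistGroupAlg conj χ).toLinearMap.lTensor A y ∈ LinearMap.range Φ := by
    intro y hy
    induction hy using Submodule.iSup_induction' with
    | zero => rw [map_zero, add_zero]; exact zero_mem _
    | add y z _ _ hy hz => rw [map_add, add_add_add_comm]; exact add_mem hy hz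
    | mem g y hy =>
      induction hy using Submodule.span_induction with
      | zero => rw [map_zero, add_zero]; exact zero_mem _
      | add y z _ _ hy hz => rw [map_add, add_add_add_comm]; exact add_mem hy hz
      | smul r y _ hy => rw [map_smul, ← smul_add]; exact Submodule.smul_mem _ r hy
      | mem y hy =>
        obtain ⟨a, ha, z, rfl⟩ := hy
        obtain ⟨b, hb, rfl⟩ := p.exists_eq ha
        -- The scalars fixed by `z ↦ conj z * χ(g)` form the line `F (w g)⁻¹`, so multiplying the
        -- symmetrized scalar by `w g` lands in `F`.
        obtain ⟨r, hr⟩ := exists_algebraMap_eq_of_conj_eq (conj := conj)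
          (z := (z + conj z * ((χ g : Kˣ) : K)) * w g) hi hK hconj (by
            rw [map_mul, map_add, map_mul, conj_conj hi hK hconj, hcw, unitCircle_conj]
            field_simp
            ring)
        refine ⟨r • b, ?_⟩
        rw [map_smul, hΦ g b hb, LinearMap.lTensor_tmul, AlgHom.toLinearMap_apply,
          twistGroupAlg_single, ← TensorProduct.tmul_add, ← MonoidAlgebra.single_add,
          ← TensorProduct.tmul_smul, MonoidAlgebra.smul_single, Algebra.smul_def, hr]
        congr 2
        field_simp
  let Ψ : B →ₗ[F] loopAlg conj Δ χ :=
    Φ.codRestrict (NonUnitalSubalgebra.toSubmodule (loopAlg conj Δ χ)) hΦmem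
  have hΨ : Function.Bijective Ψ := by
    constructor
    · refine (injective_iff_map_eq_zero _).2 fun x hx => Γ.eq_zero_of_proj fun g => hzero g x ?_
      have : Φ x = 0 := congrArg Subtype.val hx
      rw [this, map_zero]
    · rintro ⟨y, hy⟩
      obtain ⟨x, hx⟩ := hfix y hy.1
      refine ⟨(2 : F)⁻¹ • x, Subtype.ext ?_⟩
      change Φ ((2 : F)⁻¹ • x) = y
      rw [map_smul, hx, hy.2, ← two_smul F, inv_smul_smul₀ two_ne_zero]
  refine ⟨LinearEquiv.ofBijective Ψ hΨ, fun x y => Subtype.ext (hΦmul x y), fun g x =>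
    ⟨hΦext g x, fun hx => Γ.mem_of_proj fun k hk => hzero k x ?_⟩⟩
  have hx' : Φ x ∈ loopCompExt K Δ g := hx
  have hle : loopCompExt K Δ g ≤ LinearMap.ker (coeffMap A k (v k)) := by
    refine Submodule.span_le.2 ?_
    rintro _ ⟨a, -, z, rfl⟩
    exact coeffMap_tmul_single_of_ne (Ne.symm hk) _ a z
  exact hle hx'

end LoopIso

/-! ### The group of homogeneous units of the centroid. -/

section HomogeneousUnits

variable {F : Type*} [Field F] {B : Type*} [NonUnitalNonAssocRing B] [Module F B]
  [IsScalarTower F B B] [SMulCommClass F B B] {G : Type*} [CommGroup G] {Γ : Grading F B G}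

/-- The invertible homogeneous elements of the centroid, together with their degrees. -/
def homogeneousUnits (Γ : Grading F B G) : Subgroup (G × (centroid F B)ˣ) where
  carrier := {l | (l.2 : centroid F B) ∈ centroidComp F Γ l.1 ∧
    (↑l.2⁻¹ : centroid F B) ∈ centroidComp F Γ l.1⁻¹}
  one_mem' := ⟨fun h x hx => by simpa using hx, fun h x hx => by simpa using hx⟩
  mul_mem' {a b} ha hb := by
    refine ⟨fun h x hx => ?_, fun h x hx => ?_⟩
    · rw [Prod.fst_mul, mul_assoc]
      exact ha.1 _ _ (hb.1 h x hx)
    · rw [Prod.fst_mul, mul_inv_rev, mul_assoc, Prod.snd_mul, mul_inv_rev]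
      exact hb.2 _ _ (ha.2 h x hx)
  inv_mem' {a} ha := ⟨ha.2, by simpa using ha.1⟩

theorem IsGradedSimple.nontrivial_centroid (hs : IsGradedSimple F Γ) :
    Nontrivial (centroid F B) := by
  obtain ⟨x, y, hxy⟩ := hs.1
  refine ⟨⟨1, 0, fun h => hxy ?_⟩⟩
  exact DFunLike.congr_fun (congrArg Subtype.val h) (x * y)

theorem IsGradedSimple.exists_homogeneousUnit (hs : IsGradedSimple F Γ) {g : G}
    {c : centroid F B} (hc : c ∈ centroidComp F Γ g) (hc0 : c ≠ 0) :
    ∃ u : (centroid F B)ˣ, (u : centroid F B) = c ∧ (g, u) ∈ homogeneousUnits Γ := by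
  have hbij := hs.bijective c.2 hc fun h => hc0 (Subtype.ext h)
  let e := LinearEquiv.ofBijective (c : Module.End F B) hbij
  have hce : ∀ x, (c : Module.End F B) (e.symm x) = x := e.apply_symm_apply
  have hec : ∀ x, e.symm ((c : Module.End F B) x) = x := e.symm_apply_apply
  have hmem : (e.symm : Module.End F B) ∈ centroid F B := fun x y =>
    ⟨hbij.1 ((hce _).trans (by rw [(c.2 _ _).1]; exact congrArg _ (hce y).symm)),
      hbij.1 ((hce _).trans (by rw [(c.2 _ _).2]; exact congrArg (· * y) (hce x).symm))⟩
  refine ⟨⟨c, ⟨_, hmem⟩, Subtype.ext (LinearMap.ext hce), Subtype.ext (LinearMap.ext hec)⟩, rfl,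
    hc, fun h x hx => Γ.mem_of_proj fun k hk => hbij.1 ?_⟩
  rw [map_zero, ← proj_apply_of_degree hc]
  refine (congrArg _ (hce x)).trans (Γ.proj_of_mem_of_ne hx ?_)
  rintro rfl
  exact hk (by simp)

/-- The commutator is homogeneous of degree `g * h` and kills every product `x * y`. If nonzero it
would be injective, contradicting `B² ≠ 0`. -/
theorem IsGradedSimple.commute (hs : IsGradedSimple F Γ) {g h : G} {c d : centroid F B}
    (hc : c ∈ centroidComp F Γ g) (hd : d ∈ centroidComp F Γ h) : c * d = d * c := by
  by_contra hne
  have hbij := hs.bijective (c * d - d * c).2 (g := g * h)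
    (fun k x hx => Submodule.sub_mem _ (mul_assoc g h k ▸ hc _ _ (hd k x hx))
      (by rw [mul_comm g h, mul_assoc]; exact hd _ _ (hc k x hx)))
    fun h0 => hne (sub_eq_zero.1 (Subtype.ext h0))
  obtain ⟨x, y, hxy⟩ := hs.1
  refine hxy (hbij.1 ?_)
  rw [map_zero]
  change (c : Module.End F B) ((d : Module.End F B) (x * y)) -
    (d : Module.End F B) ((c : Module.End F B) (x * y)) = 0
  rw [(d.2 x y).1, (c.2 x _).2, (c.2 x y).2, (d.2 _ y).1, sub_self]

theorem IsGradedSimple.mem_support (hs : IsGradedSimple F Γ) (l : homogeneousUnits Γ) :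
    l.1.1 ∈ centroidSupport F Γ := by
  have := hs.nontrivial_centroid
  intro h
  have h0 : (l.1.2 : centroid F B) ∈ centroidComp F Γ l.1.1 := l.2.1
  rw [h] at h0
  exact l.1.2.ne_zero ((Submodule.mem_bot F).1 h0)

theorem IsGradedSimple.exists_of_mem_support (hs : IsGradedSimple F Γ) {g : G}
    (hg : g ∈ centroidSupport F Γ) : ∃ l : homogeneousUnits Γ, l.1.1 = g := by
  obtain ⟨c, hc, hc0⟩ := (Submodule.ne_bot_iff _).1 hg
  obtain ⟨u, -, hu⟩ := hs.exists_homogeneousUnit hc hc0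
  exact ⟨⟨_, hu⟩, rfl⟩

/-- The support of the centroid of a graded-simple algebra, as a subgroup. -/
def IsGradedSimple.supportSubgroup (hs : IsGradedSimple F Γ) : Subgroup G where
  carrier := centroidSupport F Γ
  one_mem' := hs.mem_support 1
  mul_mem' {a b} ha hb := by
    obtain ⟨l, rfl⟩ := hs.exists_of_mem_support ha
    obtain ⟨m, rfl⟩ := hs.exists_of_mem_support hb
    exact hs.mem_support (l * m)
  inv_mem' {a} ha := by
    obtain ⟨l, rfl⟩ := hs.exists_of_mem_support ha
    exact hs.mem_support l⁻¹

/-- The nonzero scalars as homogeneous units of trivial degree. -/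
def scalarUnits (Γ : Grading F B G) : Fˣ →* homogeneousUnits Γ :=
  ((MonoidHom.inr G (centroid F B)ˣ).comp
    (Units.map (algebraMap F (centroid F B)).toMonoidHom)).codRestrict (homogeneousUnits Γ)
    fun r => ⟨fun h x hx => by
        rw [MonoidHom.comp_apply, MonoidHom.inr_apply, one_mul]
        exact Submodule.smul_mem _ (r : F) hx,
      fun h x hx => by
        rw [MonoidHom.comp_apply, MonoidHom.inr_apply, inv_one, one_mul, ← map_inv]
        exact Submodule.smul_mem _ ((r⁻¹ : Fˣ) : F) hx⟩

theorem IsGradedSimple.scalarUnits_injective (hs : IsGradedSimple F Γ) :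
    Function.Injective (scalarUnits Γ) := by
  have := hs.nontrivial_centroid
  intro r s h
  refine Units.ext ((algebraMap F (centroid F B)).injective ?_)
  exact congrArg (fun l : homogeneousUnits Γ => (l.1.2 : centroid F B)) h

theorem IsGradedCentral.exists_scalarUnits_eq (hcen : IsGradedCentral F Γ)
    (hs : IsGradedSimple F Γ) {l : homogeneousUnits Γ} (hl : l.1.1 = 1) :
    ∃ r, scalarUnits Γ r = l := by
  have := hs.nontrivial_centroid
  obtain ⟨r, hr⟩ := hcen _ (l.1.2 : centroid F B).2 fun h x hx => by
    have := l.2.1 h x hx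
    rwa [hl, one_mul] at this
  have hr' : algebraMap F (centroid F B) r = l.1.2 :=
    Subtype.ext (LinearMap.ext fun x => (hr x).symm)
  have hr0 : r ≠ 0 := by
    rintro rfl
    rw [map_zero] at hr'
    exact l.1.2.ne_zero hr'.symm
  exact ⟨Units.mk0 r hr0, Subtype.ext (Prod.ext hl.symm (Units.ext hr'))⟩

end HomogeneousUnits

/-! ### Existence of the character and assembly. -/

section Existence

variable {F : Type*} [Field F] {K : Type*} [Field K] [Algebra F K] {i : K} {conj : K ≃ₐ[F] K}
  {B : Type u} [NonUnitalNonAssocRing B] [Module F B] [IsScalarTower F B B] [SMulCommClass F B B]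
  {G : Type*} [CommGroup G] {Γ : Grading F B G}

theorem IsGradedSimple.exists_centroidSection [IsRealClosed F] (hs : IsGradedSimple F Γ)
    (hcen : IsGradedCentral F Γ) (hi : i * i = -1) (hK : Algebra.adjoin F {i} = ⊤)
    (hconj : conj i = -i) :
    ∃ χ : G →* unitCircle conj, Nonempty (CentroidSection Γ hs.supportSubgroup χ) := by
  have := isAlgClosed_of_adjoin_sqrt_neg_one hi hK
  let : CommGroup (homogeneousUnits Γ) :=
    { (inferInstance : Group (homogeneousUnits Γ)) with
      mul_comm := fun l m => Subtype.ext (Prod.ext (mul_comm _ _)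
        (Units.ext (hs.commute l.2.1 m.2.1))) }
  have hdiv : ∀ n : ℕ, n ≠ 0 → Function.Surjective fun z : Kˣ => z ^ n := fun n hn z => by
    obtain ⟨y, hy⟩ := IsAlgClosed.exists_pow_nat_eq (z : K) (Nat.pos_of_ne_zero hn)
    have hy0 : y ≠ 0 := by
      rintro rfl
      rw [zero_pow hn] at hy
      exact z.ne_zero hy.symm
    exact ⟨Units.mk0 y hy0, Units.ext hy⟩
  obtain ⟨ρ, hρ⟩ := exists_extension_of_injective hdiv (scalarUnits Γ) hs.scalarUnits_injective
    (Units.map (algebraMap F K).toMonoidHom)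
  let conjUnits : Kˣ →* Kˣ := Units.map (conj : K →* K)
  let χ₀ : homogeneousUnits Γ →* unitCircle conj :=
    (ρ / conjUnits.comp ρ).codRestrict (unitCircle conj) fun l => by
      change ((ρ l / conjUnits (ρ l) : Kˣ) : K) * conj ((ρ l / conjUnits (ρ l) : Kˣ) : K) = 1
      have h1 : ((conjUnits (ρ l) : Kˣ) : K) = conj (ρ l : K) := rfl
      have h2 : conj (ρ l : K) ≠ 0 := h1 ▸ Units.ne_zero _
      rw [Units.val_div_eq_div_val, map_div₀, h1, conj_conj hi hK hconj]
      field_simp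
  have hχ₀ : ∀ l, (ρ l : K) = conj (ρ l : K) * ((χ₀ l : Kˣ) : K) := fun l => by
    change _ = _ * ((ρ l / conjUnits (ρ l) : Kˣ) : K)
    have h1 : ((conjUnits (ρ l) : Kˣ) : K) = conj (ρ l : K) := rfl
    rw [Units.val_div_eq_div_val, ← h1, mul_div_cancel₀ _ (Units.ne_zero _)]
  -- Units of trivial degree are scalars, where `ρ` is fixed by `conj` and `χ₀` is trivial; hence
  -- `χ₀` depends only on the degree.
  obtain ⟨χ, hχ⟩ := exists_extension_of_ker_le
    (fun n hn => pow_surjective_unitCircle (n := n) hi hK hconj hn)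
    ((MonoidHom.fst G (centroid F B)ˣ).comp (homogeneousUnits Γ).subtype) χ₀ fun l hl => by
      obtain ⟨r, rfl⟩ := hcen.exists_scalarUnits_eq hs hl
      have h := hχ₀ (scalarUnits Γ r)
      rw [hρ] at h
      have h' : conj (((Units.map (algebraMap F K).toMonoidHom) r : Kˣ) : K) =
          (((Units.map (algebraMap F K).toMonoidHom) r : Kˣ) : K) := conj.commutes _
      rw [h', eq_comm, mul_eq_left₀ (Units.ne_zero _)] at h
      exact Subtype.ext (Units.ext h)
  have hχ' : ∀ l : homogeneousUnits Γ, χ l.1.1 = χ₀ l := hχ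
  let ε : homogeneousUnits Γ →* fixedUnits conj hs.supportSubgroup χ :=
    (MonoidHom.prod ((MonoidHom.fst G (centroid F B)ˣ).comp (homogeneousUnits Γ).subtype)
      ρ).codRestrict (fixedUnits conj hs.supportSubgroup χ) fun l =>
        ⟨hs.mem_support l, (hχ₀ l).trans (by rw [← hχ' l]; rfl)⟩
  have hε₁ : ∀ l, (ε l).1.1 = l.1.1 := fun l => rfl
  have hε₂ : ∀ l, (ε l).1.2 = ρ l := fun l => rfl
  -- In each degree of `H` both sides are one-dimensional over `F` up to zero, and `ρ` restricts to
  -- the inclusion on scalars.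
  have hε : Function.Bijective ε := by
    constructor
    · refine (injective_iff_map_eq_one _).2 fun l hl => ?_
      obtain ⟨r, rfl⟩ := hcen.exists_scalarUnits_eq hs (l := l) (by rw [← hε₁, hl]; rfl)
      have h : ρ (scalarUnits Γ r) = 1 := by rw [← hε₂, hl]; rfl
      rw [hρ] at h
      have hr : r = 1 := Units.ext ((algebraMap F K).injective (by
        rw [Units.val_one, map_one]
        exact congrArg Units.val h))
      rw [hr, map_one]
    · rintro ⟨⟨h, z⟩, hh, hz⟩
      obtain ⟨l, rfl⟩ := hs.exists_of_mem_support hh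
      obtain ⟨r, hr⟩ := exists_algebraMap_eq_of_conj_eq (z := (z : K) / (ρ l : K)) hi hK hconj (by
        have h1 := hχ₀ l
        dsimp only at hz
        rw [hχ'] at hz
        have h0 : conj (ρ l : K) ≠ 0 := by simp
        rw [map_div₀, div_eq_div_iff h0 (Units.ne_zero _)]
        linear_combination conj (z : K) * h1 - conj (ρ l : K) * hz)
      have hr0 : r ≠ 0 := by
        rintro rfl
        rw [map_zero] at hr
        exact div_ne_zero (Units.ne_zero _) (Units.ne_zero _) hr.symm
      refine ⟨scalarUnits Γ (Units.mk0 r hr0) * l, Subtype.ext (Prod.ext (one_mul _) ?_)⟩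
      rw [hε₂, map_mul, hρ]
      refine Units.ext ?_
      change algebraMap F K r * (ρ l : K) = z
      rw [hr, div_mul_cancel₀ _ (Units.ne_zero _)]
  let e := MulEquiv.ofBijective ε hε
  have he : ∀ l, (e.symm l).1.1 = l.1.1 := fun l => by
    rw [← hε₁]
    exact congrArg (fun m => m.1.1) (e.apply_symm_apply l)
  refine ⟨χ, ⟨⟨(Units.coeHom _).comp ((MonoidHom.snd G (centroid F B)ˣ).comp
    ((homogeneousUnits Γ).subtype.comp e.symm.toMonoidHom)), fun l => ?_, fun l hl r hr => ?_⟩⟩⟩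
  · rw [← he l]
    exact (e.symm l).2.1
  · have hr0 : r ≠ 0 := by
      rintro rfl
      rw [map_zero] at hr
      exact l.1.2.ne_zero hr.symm
    have : e.symm l = scalarUnits Γ (Units.mk0 r hr0) := by
      rw [MulEquiv.symm_apply_eq]
      refine Subtype.ext (Prod.ext hl (Units.ext ?_))
      change (l.1.2 : K) = ((ε (scalarUnits Γ (Units.mk0 r hr0))).1.2 : K)
      rw [hε₂, hρ, ← hr]
      rfl
    change ((e.symm l).1.2 : centroid F B) = _
    rw [this]
    rfl

theorem centroidSection_of_gradedIso {H : Subgroup G} {χ : G →* unitCircle conj}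
    (h : GradedIso F (loopComp conj (trivialGrading F (G ⧸ H)) χ) (centroidComp F Γ)) :
    Nonempty (CentroidSection Γ H χ) := by
  obtain ⟨e, hmul, hdeg⟩ := h
  have hext : ∀ l : fixedUnits conj H χ, (1 : F) ⊗ₜ[F] MonoidAlgebra.single l.1.1 (l.1.2 : K) ∈
      loopCompExt K (trivialGrading F (G ⧸ H)) l.1.1 := fun l => by
    refine Submodule.subset_span ⟨1, ?_, _, rfl⟩
    have h1 : QuotientGroup.mk' H l.1.1 = 1 := (QuotientGroup.eq_one_iff _).2 l.2.1
    rw [h1]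
    simp [trivialGrading]
  let T : fixedUnits conj H χ → loopAlg conj (trivialGrading F (G ⧸ H)) χ := fun l =>
    ⟨(1 : F) ⊗ₜ[F] MonoidAlgebra.single l.1.1 (l.1.2 : K),
      Submodule.mem_iSup_of_mem _ (hext l), by
        rw [LinearMap.lTensor_tmul, AlgHom.toLinearMap_apply, twistGroupAlg_single, ← l.2.2]⟩
  have hT1 : ∀ y, T 1 * y = y := fun y => Subtype.ext <| by
    change (1 : F) ⊗ₜ[F] MonoidAlgebra.single (1 : G) (1 : K) * (y : F ⊗[F] MonoidAlgebra K G) = y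
    rw [← MonoidAlgebra.one_def, ← Algebra.TensorProduct.one_def, one_mul]
  -- A graded isomorphism is not assumed unital; being surjective and multiplicative, it takes the
  -- identity to the identity.
  have he1 : e (T 1) = 1 := by
    have := hmul (T 1) (e.symm 1)
    rwa [hT1, e.apply_symm_apply, mul_one, eq_comm] at this
  refine ⟨⟨{ toFun := fun l => e (T l), map_one' := he1, map_mul' := fun l m => ?_ },
    fun l => (hdeg l.1.1 (T l)).1 (hext l), fun l hl r hr => ?_⟩⟩
  · rw [← hmul]
    refine congrArg e (Subtype.ext ?_)
    change _ = ((1 : F) ⊗ₜ[F] MonoidAlgebra.single l.1.1 (l.1.2 : K)) *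
      ((1 : F) ⊗ₜ[F] MonoidAlgebra.single m.1.1 (m.1.2 : K))
    rw [Algebra.TensorProduct.tmul_mul_tmul, MonoidAlgebra.single_mul_single, one_mul]
    rfl
  · change e (T l) = _
    rw [Algebra.algebraMap_eq_smul_one, ← he1]
    refine Eq.trans (congrArg e (Subtype.ext ?_)) (e.map_smul r (T 1))
    change (1 : F) ⊗ₜ[F] MonoidAlgebra.single l.1.1 (l.1.2 : K) =
      r • ((1 : F) ⊗ₜ[F] MonoidAlgebra.single (1 : G) (1 : K))
    rw [← TensorProduct.tmul_smul, MonoidAlgebra.smul_single, Algebra.smul_def, mul_one, hr, hl]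

theorem CentroidSection.exists_loopAlg [CharZero F] (hs : IsGradedSimple F Γ)
    (hcen : IsGradedCentral F Γ) (hi : i * i = -1) (hK : Algebra.adjoin F {i} = ⊤)
    (hconj : conj i = -i) {χ : G →* unitCircle conj}
    (τ : CentroidSection Γ hs.supportSubgroup χ) :
    ∃ (A : Type u) (_ : NonUnitalNonAssocRing A) (_ : Module F A)
      (_ : IsScalarTower F A A) (_ : SMulCommClass F A A)
      (Δ : Grading F A (G ⧸ hs.supportSubgroup)),
      IsSimpleAlg F A ∧ IsCentralAlg F A ∧ GradedIso F Γ.comp (loopComp conj Δ χ) := by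
  obtain ⟨A, _, _, _, _, Δ, p, w, hw, hp⟩ := τ.exists_twistedCover hi hK hconj
  have hπ := QuotientGroup.mk'_surjective hs.supportSubgroup
  have hsupp := p.centroid_eq_zero hπ fun g hg => (QuotientGroup.eq_one_iff g).2 hg
  exact ⟨A, inferInstance, inferInstance, inferInstance, inferInstance, Δ,
    (p.isGradedSimple hπ hs).isSimpleAlg hsupp, (p.isGradedCentral hπ hcen).isCentralAlg hsupp,
    p.gradedIso hi hK hconj hw hp⟩

end Existence

end GradedLoop

theorem theorem3p4
    -- a real closed field `F`, and `K = F[√-1]` with its conjugation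
    {F : Type*} [Field F] [IsRealClosed F] {K : Type*} [Field K] [Algebra F K]
    (i : K) (hi : i * i = -1) (hK : Algebra.adjoin F {i} = ⊤)
    (conj : K ≃ₐ[F] K) (hconj : conj i = -i)
    -- a graded algebra `B`
    {G : Type*} [CommGroup G]
    {B : Type u} [NonUnitalNonAssocRing B] [Module F B] [IsScalarTower F B B] [SMulCommClass F B B]
    (Γ : GradedLoop.Grading F B G)
    (hsimple : GradedLoop.IsGradedSimple F Γ) (hcentral : GradedLoop.IsGradedCentral F Γ) :
    ∃ H : Subgroup G, (H : Set G) = GradedLoop.centroidSupport F Γ ∧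
      (∃ (χ : G →* GradedLoop.unitCircle conj)
        (A : Type u) (_ : NonUnitalNonAssocRing A) (_ : Module F A)
        (_ : IsScalarTower F A A) (_ : SMulCommClass F A A) (Δ : GradedLoop.Grading F A (G ⧸ H)),
        GradedLoop.IsSimpleAlg F A ∧ GradedLoop.IsCentralAlg F A ∧
          GradedLoop.GradedIso F Γ.comp (GradedLoop.loopComp conj Δ χ)) ∧
      (∀ χ : G →* GradedLoop.unitCircle conj,
        GradedLoop.GradedIso F
          (GradedLoop.loopComp conj (GradedLoop.trivialGrading F (G ⧸ H)) χ)
          (GradedLoop.centroidComp F Γ) →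
        ∃ (A : Type u) (_ : NonUnitalNonAssocRing A) (_ : Module F A)
          (_ : IsScalarTower F A A) (_ : SMulCommClass F A A) (Δ : GradedLoop.Grading F A (G ⧸ H)),
          GradedLoop.IsSimpleAlg F A ∧ GradedLoop.IsCentralAlg F A ∧
            GradedLoop.GradedIso F Γ.comp (GradedLoop.loopComp conj Δ χ)) := by
  obtain ⟨χ, ⟨τ⟩⟩ := hsimple.exists_centroidSection hcentral hi hK hconj
  refine ⟨hsimple.supportSubgroup, rfl, ⟨χ, τ.exists_loopAlg hsimple hcentral hi hK hconj⟩,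
    fun χ' h => ?_⟩
  obtain ⟨τ'⟩ := GradedLoop.centroidSection_of_gradedIso h
  exact τ'.exists_loopAlg hsimple hcentral hi hK hconj
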